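/- Let $k\in\mathbb Z$, let $\chi_i$ be a primitive Dirichlet character modulo $q_i$ for $i=1,2$ (the character modulo $1$ counts as primitive) with $\chi_1(-1)\chi_2(-1)=(-1)^k$, let $A,B\ge 1$ be integers and put $N=q_1q_2AB$. Let $\psi$ be the Dirichlet character modulo $N$ induced by $\chi_1\overline{\chi_2}$, and let $\Gamma=\Gamma_0(N)$. For $z=x+iy$ in the upper half-plane and $\operatorname{Re}(s)>1$ put $$E_{\chi_1,\chi_2}(z,s)=\frac12\sum_{\substack{c,d\in\mathbb Z\\(c,d)=1}}\frac{(q_2y)^s\chi_1(c)\chi_2(d)}{|cq_2z+d|^{2s}}\Big(\frac{|cq_2z+d|}{cq_2z+d}\Big)^k .$$ For a cusp $\mathfrak a$ of $\Gamma$ with stabilizer $\Gamma_{\mathfrak a}$ in $\Gamma$, let $\sigma_{\mathfrak a}\in SL_2(\mathbb R)$ be a scaling matrix, that is, $\sigma_{\mathfrak a}\infty=\mathfrak a$ and $\sigma_{\mathfrak a}^{-1}\Gamma_{\mathfrak a}\sigma_{\mathfrak a}=\{\pm\left(\begin{smallmatrix}1&b\\0&1\end{smallmatrix}\right):b\in\mathbb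 Z\}$; if $k$ is odd, and $\mathfrak a=1/w$ with $w\in\mathbb Z$ (where $1/0=\infty$), choose its sign so that its upper left entry is positive. For $\operatorname{Re}(s)>1$ put $$E_{\mathfrak a}(z,s,\psi)=\sum_{\gamma\in\Gamma_{\mathfrak a}\backslash\Gamma}\overline\psi(\gamma)\,j(\sigma_{\mathfrak a}^{-1}\gamma,z)^{-k}\,(\operatorname{Im}\sigma_{\mathfrak a}^{-1}\gamma z)^s,\qquad j\Big(\begin{pmatrix}a&b\\c&d\end{pmatrix},z\Big)=\frac{cz+d}{|cz+d|},$$ where $\psi(\gamma)$ is the value of $\psi$ at the lower right entry of $\gamma$. For coprime $d\mid A$ and $e\mid B$ put $f_{d,e}=q_2\frac{Bd}{e}$ and $m_{d,e}=\big(q_2\frac{Bd}{e},\,q_1\frac{Ae}{d}\big)$, and choose a set $R_{d,e}$ of integers coprime to $N$ that represents each class of $(\mathbb Z/m_{d,e}\mathbb Z)^*$ exactly once. Then, for every $z$ in the upper half-plane: (a) For each cusp $\mathfrak a=\frac1{uf_{d,e}}$ with $u\in R_{d,e}$, the summand of $E_{\mathfrak a}(z,s,\psi)$ depends only on the coset $\Gamma_{\mathfrak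 a}\gamma$. (b) For $\operatorname{Re}(s)>1$ the series $E_{\chi_1,\chi_2}(Bz,s)$ and $E_{1/(uf_{d,e})}(z,s,\psi)$ converge absolutely, and $$E_{\chi_1,\chi_2}(Bz,s)=\sum_{\substack{d\mid A,\ e\mid B\\(d,e)=1}}\frac{\chi_1(d)\chi_2(e)}{(de)^s}\Big(\frac{N}{m_{d,e}}\Big)^s\sum_{u\in R_{d,e}}\chi_1(-u)\,E_{\frac{1}{uf_{d,e}}}(z,s,\psi).$$ (c) The identity persists under analytic continuation: if functions meromorphic in $s\in\mathbb C$ agree for $\operatorname{Re}(s)>1$ with $E_{\chi_1,\chi_2}(Bz,s)$ and with the $E_{1/(uf_{d,e})}(z,s,\psi)$ that occur, then these functions satisfy the same identity at every $s\in\mathbb C$ at which all of them are analytic. -/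

import Mathlib

open scoped MatrixGroups ComplexConjugate UpperHalfPlane
open UpperHalfPlane

namespace EisensteinCusps

noncomputable section

/-! ### Eisenstein series attached to a pair of Dirichlet characters -/

/-- The term of index `(c, d)` of the series defining `E_{χ₁, χ₂}(z, s)` in weight `k`:
`(q₂ y)^s χ₁(c) χ₂(d) |c q₂ z + d|^{-2s} (|c q₂ z + d| / (c q₂ z + d))^k`. -/
def charTerm {q₁ q₂ : ℕ} (k : ℤ) (χ₁ : DirichletCharacter ℂ q₁) (χ₂ : DirichletCharacter ℂ q₂)
    (z s : ℂ) (p : ℤ × ℤ) : ℂ :=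
  (((q₂ * z.im : ℝ) : ℂ) ^ s * χ₁ (p.1 : ZMod q₁) * χ₂ (p.2 : ZMod q₂)) /
      ((‖(p.1 : ℂ) * q₂ * z + p.2‖ : ℝ) : ℂ) ^ (2 * s) *
    (((‖(p.1 : ℂ) * q₂ * z + p.2‖ : ℝ) : ℂ) / ((p.1 : ℂ) * q₂ * z + p.2)) ^ k

/-- `E_{χ₁, χ₂}(z, s)` in weight `k`: half the sum of the terms over all coprime pairs `(c, d)`
of integers. -/
def charEisenstein {q₁ q₂ : ℕ} (k : ℤ) (χ₁ : DirichletCharacter ℂ q₁)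
    (χ₂ : DirichletCharacter ℂ q₂) (z s : ℂ) : ℂ :=
  (1 / 2 : ℂ) * ∑' p : {p : ℤ × ℤ // IsCoprime p.1 p.2}, charTerm k χ₁ χ₂ z s p.1

/-! ### Cusps, scaling matrices, Eisenstein series attached to cusps -/

/-- The homomorphism `Γ₀(N) → SL(2, ℝ)`. -/
def toReal (N : ℕ) : CongruenceSubgroup.Gamma0 N →* SL(2, ℝ) :=
  (Matrix.SpecialLinearGroup.map (Int.castRingHom ℝ)).comp (CongruenceSubgroup.Gamma0 N).subtype

/-- The stabilizer `Γ_𝔞` of the cusp `𝔞` in `Γ = Γ₀(N)`, as a subgroup of `Γ`. -/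
def cuspStabilizer (N : ℕ) (a : OnePoint ℝ) : Subgroup (CongruenceSubgroup.Gamma0 N) :=
  (MulAction.stabilizer (GL (Fin 2) ℝ) a).comap
    (Matrix.SpecialLinearGroup.toGL.comp (toReal N))

/-- The unipotent matrix with rows `(1, b)` and `(0, 1)`. -/
def unipotent (b : ℝ) : SL(2, ℝ) :=
  ⟨!![1, b; 0, 1], by simp [Matrix.det_fin_two]⟩

/-- `σ` is a scaling matrix of the cusp `𝔞` of `Γ₀(N)`: one has `σ ∞ = 𝔞`, and
`σ⁻¹ Γ_𝔞 σ` is the group of all `±(1 b; 0 1)` with `b ∈ ℤ`. -/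
def IsScalingMatrix (N : ℕ) (a : OnePoint ℝ) (σ : SL(2, ℝ)) : Prop :=
  Matrix.SpecialLinearGroup.toGL σ • (OnePoint.infty : OnePoint ℝ) = a ∧
    (fun γ : CongruenceSubgroup.Gamma0 N => σ⁻¹ * toReal N γ * σ) '' (cuspStabilizer N a) =
      {g : SL(2, ℝ) | ∃ b : ℤ, g = unipotent b ∨ g = -unipotent b}

/-- The automorphy factor `j(g, z) = (c z + d) / |c z + d|`. -/
def jFactor (g : SL(2, ℝ)) (z : ℍ) : ℂ :=
  (((g.1 1 0 : ℝ) : ℂ) * z + ((g.1 1 1 : ℝ) : ℂ)) /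
    ((‖((g.1 1 0 : ℝ) : ℂ) * z + ((g.1 1 1 : ℝ) : ℂ)‖ : ℝ) : ℂ)

/-- The term `ψ̄(γ) j(σ⁻¹ γ, z)^{-k} (Im σ⁻¹ γ z)^s` of the Eisenstein series of a cusp with
scaling matrix `σ`; here `ψ(γ)` is the value of `ψ` at the lower right entry of `γ`. -/
def cuspTerm (N : ℕ) (k : ℤ) (ψ : DirichletCharacter ℂ N) (σ : SL(2, ℝ)) (z : ℍ) (s : ℂ)
    (γ : CongruenceSubgroup.Gamma0 N) : ℂ :=
  conj (ψ (((γ : SL(2, ℤ)).1 1 1 : ℤ) : ZMod N)) *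
    jFactor (σ⁻¹ * toReal N γ) z ^ (-k) *
    ((((σ⁻¹ * toReal N γ) • z).im : ℝ) : ℂ) ^ s

/-- The coset space `Γ_𝔞 \ Γ`: `γ` and `γ'` are identified when `γ' γ⁻¹ ∈ Γ_𝔞`. -/
abbrev CuspCosets (N : ℕ) (a : OnePoint ℝ) : Type :=
  Quotient (QuotientGroup.rightRel (cuspStabilizer N a))

/-- The Eisenstein series `E_𝔞(z, s, ψ)` of weight `k` and nebentypus `ψ` attached to the cusp
`𝔞` of `Γ₀(N)` with scaling matrix `σ`: the sum of the terms over `Γ_𝔞 \ Γ`.  When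
`ψ(-1) = (-1)^k` and `𝔞` is singular for `ψ`, the term of `γ` depends only on the coset of `γ`,
so that the choice of the representatives of the cosets is immaterial. -/
def cuspEisenstein (N : ℕ) (k : ℤ) (ψ : DirichletCharacter ℂ N) (a : OnePoint ℝ) (σ : SL(2, ℝ))
    (z : ℍ) (s : ℂ) : ℂ :=
  ∑' c : CuspCosets N a, cuspTerm N k ψ σ z s (Quotient.out c)

/-- The cusp `1 / w`, with `1 / 0 = ∞`. -/
def cuspInv (w : ℤ) : OnePoint ℝ :=
  if w = 0 then OnePoint.infty else ((1 / (w : ℝ) : ℝ) : OnePoint ℝ)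

/-! ### The linear combination of Eisenstein series attached to cusps -/

/-- `R` is a set of representatives of `(ℤ/mℤ)ˣ`, chosen coprime to `N`. -/
def IsUnitReps (N m : ℕ) (R : Finset ℤ) : Prop :=
  (∀ u ∈ R, IsCoprime u (N : ℤ)) ∧
    ∀ a : (ZMod m)ˣ, ∃! u : ℤ, u ∈ R ∧ (u : ZMod m) = (a : ZMod m)

/-- The pairs `(d, e)` with `d ∣ A`, `e ∣ B` and `(d, e) = 1`. -/
def coprimeDivisors (A B : ℕ) : Finset (ℕ × ℕ) :=
  (A.divisors ×ˢ B.divisors).filter fun p => Nat.Coprime p.1 p.2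

/-- The gcd `(q₂ B d / e, q₁ A e / d)`, for `p = (d, e)`. -/
def gcdModulus (q₁ q₂ A B : ℕ) (p : ℕ × ℕ) : ℕ :=
  Nat.gcd (q₂ * (B * p.1 / p.2)) (q₁ * (A * p.2 / p.1))

/-- The denominators `u q₂ B d / e` of the cusps that occur. -/
def cuspDenominators (q₂ A B : ℕ) (R : ℕ × ℕ → Finset ℤ) : Set ℤ :=
  {w | ∃ p ∈ coprimeDivisors A B, ∃ u ∈ R p, w = u * ((q₂ * (B * p.1 / p.2) : ℕ) : ℤ)}

/-- The linear combination
`∑_{(d, e)} χ₁(d) χ₂(e) (d e)^{-s} (N / m)^s ∑_u χ₁(-u) F(u q₂ B d / e)`, where `(d, e)` runs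
over the coprime pairs with `d ∣ A`, `e ∣ B`, where `m = (q₂ B d / e, q₁ A e / d)`, and where `u`
runs over the representatives `R (d, e)` of `(ℤ/mℤ)ˣ`. -/
def cuspCombination {q₁ q₂ : ℕ} (χ₁ : DirichletCharacter ℂ q₁) (χ₂ : DirichletCharacter ℂ q₂)
    (N A B : ℕ) (R : ℕ × ℕ → Finset ℤ) (s : ℂ) (F : ℤ → ℂ) : ℂ :=
  ∑ p ∈ coprimeDivisors A B,
    χ₁ (p.1 : ZMod q₁) * χ₂ (p.2 : ZMod q₂) / ((p.1 * p.2 : ℕ) : ℂ) ^ s *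
      ((N : ℂ) / (gcdModulus q₁ q₂ A B p : ℂ)) ^ s *
      ∑ u ∈ R p, χ₁ ((-u : ℤ) : ZMod q₁) * F (u * ((q₂ * (B * p.1 / p.2) : ℕ) : ℤ))

end

end EisensteinCusps

/-!
The term of a coset `Γ_𝔞 γ` for the cusp `𝔞 = 1 / w` depends on `γ` only through the row vector
`(-w, 1) γ = (c, d)` and the nebentypus at `γ`: a scaling matrix `σ` of `1 / w` has first column
`a (1, w)`, so the bottom row of `σ⁻¹ γ` is `a (c, d)`, and `a ^ 2` is the width of the cusp
(`IsScalingMatrix.sq_apply_zero_zero`, `cuspTerm_eq`).  The stabilizer acts on such rows by signs,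
and the nebentypus compensates this sign because `q₁` and `q₂` divide the least common multiple of
`f` and `N / f`, where `w = u f` (`cuspTerm_mul`).

For `f = q₂ B d / e` and `g = N / f = q₁ A e / d`, the width is `g / m` with `m = (f, g)`.  The rows
that occur for the cusp `1 / (u f)` are the coprime pairs `(f C, D)` with `(C, g) = 1` and
`C D ≡ -u` modulo `m` (`cuspRow_spec`, `exists_cuspRow_eq`), and on them
`χ₁(-u) ψ̄(γ) = χ₁(C) χ₂(D)` (`nebentypus_of_cuspRow`).  Hence the term of the row `(f C, D)` is, up
to the constant in the linear combination, the term of `E_{χ₁, χ₂}(B z, s)` at the pair `(d C, e D)`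
(`charTerm_cosetPair`).  Conversely, a coprime pair at which the characters do not vanish is
`(d C, e D)` in exactly one way: `d` and `e` are its gcds with `A` and `B`, and `u` is the
representative of `-C D` modulo `m` (`cosetPair_spec`, `exists_cosetPair_eq`).  So the two sides are
rearrangements of the same absolutely convergent series, each row being counted with both signs.

The identity extends to `ℂ` since a meromorphic function vanishing on a half-plane vanishes
wherever it is continuous (`eq_zero_of_meromorphic`).
-/

namespace EisensteinCusps

/-! ### Cusps and scaling matrices -/

lemma smul_infty_eq_cuspInv_iff (g : SL(2, ℝ)) (w : ℤ) :
    Matrix.SpecialLinearGroup.toGL g • (OnePoint.infty : OnePoint ℝ) = cuspInv w ↔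
      g.1 1 0 = w * g.1 0 0 := by
  have hdet : g.1 0 0 * g.1 1 1 - g.1 0 1 * g.1 1 0 = 1 := by
    rw [← Matrix.det_fin_two]; exact g.2
  rw [OnePoint.smul_infty_eq_ite]
  change (if g.1 1 0 = 0 then OnePoint.infty else ((g.1 0 0 / g.1 1 0 : ℝ) : OnePoint ℝ)) = _ ↔ _
  unfold cuspInv
  by_cases hw : w = 0
  · by_cases h : g.1 1 0 = 0 <;> simp [hw, h]
  · have hw' : (w : ℝ) ≠ 0 := by exact_mod_cast hw
    by_cases h : g.1 1 0 = 0
    · have h0 : g.1 0 0 ≠ 0 := by rintro h0; simp [h0, h] at hdet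
      simp [hw, h, hw', h0]
    · simp only [h, hw, if_false, OnePoint.coe_eq_coe]
      rw [div_eq_div_iff h hw']
      constructor <;> intro H <;> linarith

/-- The row vector `(-w, 1) γ`; up to sign it determines the coset of `γ` modulo the stabilizer of
the cusp `1 / w`. -/
def cuspRow (w : ℤ) (γ : SL(2, ℤ)) : ℤ × ℤ :=
  (γ.1 1 0 - w * γ.1 0 0, γ.1 1 1 - w * γ.1 0 1)

lemma sl_det (γ : SL(2, ℤ)) : γ.1 0 0 * γ.1 1 1 - γ.1 0 1 * γ.1 1 0 = 1 := by
  rw [← Matrix.det_fin_two]; exact γ.2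

lemma toReal_apply (N : ℕ) (γ : CongruenceSubgroup.Gamma0 N) (i j : Fin 2) :
    (toReal N γ).1 i j = ((γ.1.1 i j : ℤ) : ℝ) := rfl

/-- The bottom row of `σ⁻¹ γ` depends on `σ` only through the cusp and the upper left entry. -/
lemma inv_mul_bottom_row {N : ℕ} {w : ℤ} {σ : SL(2, ℝ)} (hσ : σ.1 1 0 = w * σ.1 0 0)
    (γ : CongruenceSubgroup.Gamma0 N) :
    (σ⁻¹ * toReal N γ).1 1 0 = σ.1 0 0 * (cuspRow w γ.1).1 ∧
      (σ⁻¹ * toReal N γ).1 1 1 = σ.1 0 0 * (cuspRow w γ.1).2 := by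
  have h : ∀ j, (σ⁻¹ * toReal N γ).1 1 j = (σ⁻¹).1 1 0 * (γ.1.1 0 j : ℝ) +
      (σ⁻¹).1 1 1 * (γ.1.1 1 j : ℝ) := by
    intro j
    change (((σ⁻¹).1 * (toReal N γ).1 : Matrix _ _ ℝ)) 1 j = _
    rw [Matrix.mul_apply, Fin.sum_univ_two, toReal_apply, toReal_apply]
  have h10 : (σ⁻¹).1 1 0 = -(w * σ.1 0 0) := by
    rw [← hσ, Matrix.SpecialLinearGroup.coe_inv, Matrix.adjugate_fin_two]; rfl
  have h11 : (σ⁻¹).1 1 1 = σ.1 0 0 := by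
    rw [Matrix.SpecialLinearGroup.coe_inv, Matrix.adjugate_fin_two]; rfl
  rw [h, h, h10, h11]
  simp only [cuspRow]
  push_cast
  constructor <;> ring

lemma mem_cuspStabilizer_of_smul {N : ℕ} {w : ℤ} {δ : CongruenceSubgroup.Gamma0 N} {η : ℤ}
    (h0 : δ.1.1 0 0 + w * δ.1.1 0 1 = η) (h1 : δ.1.1 1 0 + w * δ.1.1 1 1 = w * η) :
    δ ∈ cuspStabilizer N (cuspInv w) := by
  let τ : SL(2, ℝ) := ⟨!![1, 0; (w : ℝ), 1], by simp [Matrix.det_fin_two]⟩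
  have hτ : Matrix.SpecialLinearGroup.toGL τ • (OnePoint.infty : OnePoint ℝ) = cuspInv w :=
    (smul_infty_eq_cuspInv_iff τ w).2 (by simp [τ])
  change Matrix.SpecialLinearGroup.toGL (toReal N δ) • cuspInv w = cuspInv w
  conv_lhs => rw [← hτ]
  rw [← mul_smul, ← map_mul, smul_infty_eq_cuspInv_iff]
  change ((toReal N δ).1 * τ.1 : Matrix _ _ ℝ) 1 0 = w * ((toReal N δ).1 * τ.1 : Matrix _ _ ℝ) 0 0
  rw [Matrix.mul_apply, Matrix.mul_apply, Fin.sum_univ_two, Fin.sum_univ_two]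
  simp only [toReal_apply, τ]
  have h0' : (δ.1.1 0 0 : ℝ) + w * δ.1.1 0 1 = η := by exact_mod_cast h0
  have h1' : (δ.1.1 1 0 : ℝ) + w * δ.1.1 1 1 = w * η := by exact_mod_cast h1
  simp
  rw [mul_comm _ (w : ℝ), mul_comm _ (w : ℝ), h0', h1']

/-- An element with `(-w, 1) δ = η (-w, 1)`, `η = ± 1`, fixes the cusp `1 / w`. -/
lemma mem_cuspStabilizer_of_cuspRow {N : ℕ} {w : ℤ} {δ : CongruenceSubgroup.Gamma0 N} {η : ℤ}
    (hη : η * η = 1) (h : cuspRow w δ.1 = (-(η * w), η)) :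
    δ ∈ cuspStabilizer N (cuspInv w) := by
  have hd := sl_det δ.1
  simp only [cuspRow, Prod.mk.injEq] at h
  obtain ⟨h1, h2⟩ := h
  have h3 : δ.1.1 1 0 = w * δ.1.1 0 0 - η * w := by linarith
  have h4 : δ.1.1 1 1 = w * δ.1.1 0 1 + η := by linarith
  have h5 : δ.1.1 0 0 + w * δ.1.1 0 1 = η := by
    rw [h3, h4] at hd
    linear_combination η * hd - (δ.1.1 0 0 + w * δ.1.1 0 1) * hη
  exact mem_cuspStabilizer_of_smul h5 (by rw [h3, h4]; linear_combination w * h5)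

/-- Conjugating back `η (1 b; 0 1)` by a scaling matrix `σ` of `1 / w` gives the matrix
`η (1 - b w a², b a²; -b w² a², 1 + b w a²)`, where `a` is the upper left entry of `σ`. -/
lemma eq_of_conj_eq {N : ℕ} {w : ℤ} {σ : SL(2, ℝ)} (hσ : σ.1 1 0 = w * σ.1 0 0)
    {δ : CongruenceSubgroup.Gamma0 N} {b : ℝ} {g : SL(2, ℝ)} (h : σ⁻¹ * toReal N δ * σ = g)
    {η : ℝ} (hg : g.1 = η • (unipotent b).1) :
    (δ.1.1 0 0 : ℝ) = η * (1 - b * w * σ.1 0 0 ^ 2) ∧ (δ.1.1 0 1 : ℝ) = η * (b * σ.1 0 0 ^ 2) ∧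
      (δ.1.1 1 0 : ℝ) = -(η * (b * w ^ 2 * σ.1 0 0 ^ 2)) ∧
      (δ.1.1 1 1 : ℝ) = η * (1 + b * w * σ.1 0 0 ^ 2) := by
  have h' : toReal N δ = σ * g * σ⁻¹ := by rw [← h]; group
  have hm : (toReal N δ).1 = σ.1 * (η • (unipotent b).1) * (σ⁻¹).1 := by
    rw [h', ← hg]; rfl
  have hdet : σ.1 0 0 * σ.1 1 1 - σ.1 0 1 * σ.1 1 0 = 1 := by
    rw [← Matrix.det_fin_two]; exact σ.2
  rw [hσ] at hdet
  simp only [← toReal_apply N δ, hm]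
  rw [Matrix.SpecialLinearGroup.coe_inv, Matrix.adjugate_fin_two]
  simp only [Matrix.mul_apply, Fin.sum_univ_two, unipotent, Matrix.smul_apply, hσ, Matrix.of_apply,
    Matrix.cons_val', Matrix.cons_val_zero, Matrix.cons_val_one, Matrix.cons_val_fin_one,
    smul_eq_mul]
  refine ⟨?_, ?_, ?_, ?_⟩
  · linear_combination η * hdet
  · ring
  · ring
  · linear_combination η * hdet

lemma IsScalingMatrix.apply_one_zero {N : ℕ} {w : ℤ} {σ : SL(2, ℝ)}
    (h : IsScalingMatrix N (cuspInv w) σ) : σ.1 1 0 = w * σ.1 0 0 :=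
  (smul_infty_eq_cuspInv_iff σ w).1 h.1

lemma IsScalingMatrix.apply_zero_zero_ne {N : ℕ} {w : ℤ} {σ : SL(2, ℝ)}
    (h : IsScalingMatrix N (cuspInv w) σ) : σ.1 0 0 ≠ 0 := by
  intro h0
  have hdet : σ.1 0 0 * σ.1 1 1 - σ.1 0 1 * σ.1 1 0 = 1 := by
    rw [← Matrix.det_fin_two]; exact σ.2
  simp [h.apply_one_zero, h0] at hdet

lemma exists_of_mem_cuspStabilizer {N : ℕ} {w : ℤ} {σ : SL(2, ℝ)}
    (h : IsScalingMatrix N (cuspInv w) σ) {δ : CongruenceSubgroup.Gamma0 N}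
    (hδ : δ ∈ cuspStabilizer N (cuspInv w)) :
    ∃ (b : ℤ) (η : ℤˣ), (δ.1.1 0 0 : ℝ) = η * (1 - b * w * σ.1 0 0 ^ 2) ∧
      (δ.1.1 0 1 : ℝ) = η * (b * σ.1 0 0 ^ 2) ∧
      (δ.1.1 1 0 : ℝ) = -(η * (b * w ^ 2 * σ.1 0 0 ^ 2)) ∧
      (δ.1.1 1 1 : ℝ) = η * (1 + b * w * σ.1 0 0 ^ 2) := by
  have : σ⁻¹ * toReal N δ * σ ∈ {g : SL(2, ℝ) | ∃ b : ℤ, g = unipotent b ∨ g = -unipotent b} := by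
    rw [← h.2]; exact ⟨δ, hδ, rfl⟩
  obtain ⟨b, hb | hb⟩ := this
  · exact ⟨b, 1, by simpa using eq_of_conj_eq h.apply_one_zero hb (η := 1) (by simp)⟩
  · exact ⟨b, -1, by simpa using eq_of_conj_eq h.apply_one_zero hb (η := -1) (by simp)⟩

/-! ### The width of a cusp and the nebentypus on its stabilizer -/

/-- For `w = u f`, the lower left entry `-w² t` of the unipotent matrix fixing `1 / w` with upper
right entry `t` is divisible by the level `f g` exactly when `h = g / (f, g)` divides `t`. -/
lemma dvd_iff_lower_left {f g m h : ℕ} (hf : 0 < f)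
    (hm : m = Nat.gcd f g) (hh : g = m * h) {u : ℤ} (hu : IsCoprime u ((f * g : ℕ) : ℤ)) (t : ℤ) :
    ((f * g : ℕ) : ℤ) ∣ (u * f) ^ 2 * t ↔ (h : ℤ) ∣ t := by
  obtain ⟨f', hf'⟩ : m ∣ f := hm ▸ Nat.gcd_dvd_left f g
  have hm0 : 0 < m := hm ▸ Nat.gcd_pos_of_pos_left g hf
  have hcop : IsCoprime (h : ℤ) (f' : ℤ) := by
    rw [Nat.isCoprime_iff_coprime, Nat.coprime_comm]
    have : m * Nat.gcd f' h = m * 1 := by rw [← Nat.gcd_mul_left, ← hf', ← hh, ← hm, mul_one]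
    exact Nat.eq_of_mul_eq_mul_left hm0 this
  have huh : IsCoprime (h : ℤ) u := by
    refine (hu.of_isCoprime_of_dvd_right ?_).symm
    exact_mod_cast (Dvd.intro_left m hh.symm).mul_left f
  have hf'0 : 0 < f' := by rw [hf'] at hf; exact Nat.pos_of_mul_pos_left hf
  have hmz : (m : ℤ) ^ 2 * f' ≠ 0 := by positivity
  have key : ((f * g : ℕ) : ℤ) ∣ (u * f) ^ 2 * t ↔
      (m : ℤ) ^ 2 * f' * h ∣ (m : ℤ) ^ 2 * f' * (u ^ 2 * f' * t) := by
    have e1 : ((f * g : ℕ) : ℤ) = (m : ℤ) ^ 2 * f' * h := by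
      rw [hf', hh]; push_cast; ring
    have e2 : (u * f) ^ 2 * t = (m : ℤ) ^ 2 * f' * (u ^ 2 * f' * t) := by
      rw [hf']; push_cast; ring
    rw [e1, e2]
  rw [key, mul_dvd_mul_iff_left hmz]
  exact ⟨((huh.pow_right (n := 2)).mul_right hcop).dvd_of_dvd_mul_left, fun H => H.mul_left _⟩

/-- The cusp `1 / (u f)` of `Γ₀(f g)` has width `h = g / (f, g)`. -/
lemma IsScalingMatrix.sq_apply_zero_zero {N f g m h : ℕ} (hN : N = f * g) (hf : 0 < f) (hg : 0 < g)
    (hm : m = Nat.gcd f g) (hh : g = m * h) {u : ℤ} (hu : IsCoprime u (N : ℤ))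
    {σ : SL(2, ℝ)} (hσ : IsScalingMatrix N (cuspInv (u * f)) σ) :
    σ.1 0 0 ^ 2 = h := by
  have hdvd := dvd_iff_lower_left hf hm hh (hN ▸ hu)
  rw [← hN] at hdvd
  have hh0 : 0 < h := by rw [hh] at hg; exact Nat.pos_of_mul_pos_left hg
  have ha := hσ.apply_zero_zero_ne
  set a := σ.1 0 0 with ha_def
  set w : ℤ := u * f with hw
  -- The unit translation lies in the conjugated stabilizer, so `a ^ 2` is a multiple of `h`.
  have h1 : unipotent 1 ∈ {g : SL(2, ℝ) | ∃ b : ℤ, g = unipotent b ∨ g = -unipotent b} :=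
    ⟨1, by simp⟩
  rw [← hσ.2] at h1
  obtain ⟨γ, -, hγ⟩ := h1
  obtain ⟨-, e01, e10, -⟩ := eq_of_conj_eq hσ.apply_one_zero hγ (η := 1) (b := 1) (by simp)
  simp only [one_mul, ← ha_def] at e01 e10
  have e10' : γ.1.1 1 0 = -(w ^ 2 * γ.1.1 0 1) := by
    have : (γ.1.1 1 0 : ℝ) = -(w ^ 2 * γ.1.1 0 1) := by rw [e10, e01]
    exact_mod_cast this
  have hd : (h : ℤ) ∣ γ.1.1 0 1 := by
    rw [← hdvd]
    have := CongruenceSubgroup.Gamma0_mem.1 γ.2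
    rw [ZMod.intCast_zmod_eq_zero_iff_dvd] at this
    change (N : ℤ) ∣ γ.1.1 1 0 at this
    rwa [e10', dvd_neg] at this
  -- Conversely the stabilizer has an element whose upper right entry is `h`.
  let δ' : SL(2, ℤ) := ⟨!![1 - w * h, h; -(w ^ 2 * h), 1 + w * h], by
    rw [Matrix.det_fin_two_of]; ring⟩
  let δ : CongruenceSubgroup.Gamma0 N := ⟨δ', by
    rw [CongruenceSubgroup.Gamma0_mem, ZMod.intCast_zmod_eq_zero_iff_dvd]
    change (N : ℤ) ∣ -(w ^ 2 * h)
    rw [dvd_neg, hdvd]⟩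
  have hδ : δ ∈ cuspStabilizer N (cuspInv w) := by
    refine mem_cuspStabilizer_of_cuspRow (η := 1) (by norm_num) ?_
    change (-(w ^ 2 * (h : ℤ)) - w * (1 - w * h), 1 + w * (h : ℤ) - w * h) = _
    ext
    · simp; ring
    · simp
  obtain ⟨b, η, -, e, -⟩ := exists_of_mem_cuspStabilizer hσ hδ
  have e' : (h : ℤ) = η * (b * γ.1.1 0 1) := by
    have : (h : ℝ) = η * (b * γ.1.1 0 1) := by
      rw [e01]; exact e
    exact_mod_cast this
  have hd' : γ.1.1 0 1 ∣ (h : ℤ) := ⟨η * b, by rw [e']; ring⟩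
  have hpos : 0 ≤ γ.1.1 0 1 := by
    have : (0 : ℝ) ≤ γ.1.1 0 1 := by rw [e01]; positivity
    exact_mod_cast this
  have := Int.dvd_antisymm (by positivity) hpos hd hd'
  rw [← e01, ← this]
  simp

/-- Every element of the stabilizer of `1 / w` acts on the row vector `(-w, 1)` by a sign. -/
lemma cuspRow_mul_of_mem_cuspStabilizer {N : ℕ} {w : ℤ} {σ : SL(2, ℝ)} {h : ℕ}
    (hσ : IsScalingMatrix N (cuspInv w) σ) (hh : σ.1 0 0 ^ 2 = h)
    {δ : CongruenceSubgroup.Gamma0 N} (hδ : δ ∈ cuspStabilizer N (cuspInv w)) :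
    ∃ (b : ℤ) (η : ℤˣ), δ.1.1 1 1 = η * (1 + b * (w * h)) ∧
      ∀ γ : CongruenceSubgroup.Gamma0 N,
        cuspRow w (δ * γ).1 = (η * (cuspRow w γ.1).1, η * (cuspRow w γ.1).2) := by
  obtain ⟨b, η, e00, e01, e10, e11⟩ := exists_of_mem_cuspStabilizer hσ hδ
  rw [hh] at e00 e01 e10 e11
  have e00' : δ.1.1 0 0 = η * (1 - b * w * h) := by exact_mod_cast e00
  have e01' : δ.1.1 0 1 = η * (b * h) := by exact_mod_cast e01
  have e10' : δ.1.1 1 0 = -(η * (b * w ^ 2 * h)) := by exact_mod_cast e10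
  have e11' : δ.1.1 1 1 = η * (1 + b * w * h) := by exact_mod_cast e11
  refine ⟨b, η, by rw [e11']; ring, fun γ => ?_⟩
  have hmul : ∀ i j, (δ * γ).1.1 i j = δ.1.1 i 0 * γ.1.1 0 j + δ.1.1 i 1 * γ.1.1 1 j := by
    intro i j
    change (δ.1.1 * γ.1.1) i j = _
    rw [Matrix.mul_apply, Fin.sum_univ_two]
  simp only [cuspRow, hmul, e00', e01', e10', e11']
  ext <;> simp only <;> ring

lemma conj_eq_of_sq {x : ℂ} (h : x * x = 1) : conj x = x := by
  rcases mul_self_eq_one_iff.1 h with rfl | rfl <;> simp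

lemma apply_unit_mul_self {q : ℕ} (χ : DirichletCharacter ℂ q) (η : ℤˣ) :
    χ ((η : ℤ) : ZMod q) * χ ((η : ℤ) : ZMod q) = 1 := by
  rw [← map_mul, ← Int.cast_mul]; simp

lemma parity_unit {k : ℤ} {q₁ q₂ : ℕ} {χ₁ : DirichletCharacter ℂ q₁} {χ₂ : DirichletCharacter ℂ q₂}
    (hpar : χ₁ (-1) * χ₂ (-1) = (-1 : ℂ) ^ k) (η : ℤˣ) :
    χ₁ ((η : ℤ) : ZMod q₁) * χ₂ ((η : ℤ) : ZMod q₂) = ((η : ℤ) : ℂ) ^ k := by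
  rcases Int.units_eq_one_or η with rfl | rfl <;> simp [hpar]

/-- The cusp is singular: up to the sign prescribed by the weight, the nebentypus is trivial on
the stabilizer, since `q₁` and `q₂` divide the least common multiple `f h` of `f` and `g`. -/
lemma nebentypus_of_stabilizer {k : ℤ} {N f g m h q₁ q₂ : ℕ}
    (hm : m = Nat.gcd f g) (hh : g = m * h) (hq₂ : q₂ ∣ f) (hq₁ : q₁ ∣ g)
    {χ₁ : DirichletCharacter ℂ q₁} {χ₂ : DirichletCharacter ℂ q₂}
    (hpar : χ₁ (-1) * χ₂ (-1) = (-1 : ℂ) ^ k) {ψ : DirichletCharacter ℂ N}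
    (hψ : ∀ n : ℤ, IsCoprime n (N : ℤ) →
      ψ (n : ZMod N) = χ₁ (n : ZMod q₁) * conj (χ₂ (n : ZMod q₂)))
    {η : ℤˣ} {b u n : ℤ} (hn : n = η * (1 + b * (u * f * h))) (hc : IsCoprime n (N : ℤ)) :
    ψ (n : ZMod N) = ((η : ℤ) : ℂ) ^ k := by
  obtain ⟨f', hf'⟩ : m ∣ f := hm ▸ Nat.gcd_dvd_left f g
  have h₁ : (n : ZMod q₁) = ((η : ℤ) : ZMod q₁) := by
    have : ((f * h : ℕ) : ZMod q₁) = 0 := by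
      rw [ZMod.natCast_eq_zero_iff]
      have : f * h = f' * g := by rw [hf', hh]; ring
      exact this ▸ hq₁.mul_left f'
    push_cast at this
    rw [hn]; push_cast
    linear_combination ((η : ℤ) : ZMod q₁) * b * u * this
  have h₂ : (n : ZMod q₂) = ((η : ℤ) : ZMod q₂) := by
    have : ((f : ℕ) : ZMod q₂) = 0 := by
      rwa [ZMod.natCast_eq_zero_iff]
    rw [hn]; push_cast
    linear_combination ((η : ℤ) : ZMod q₂) * b * u * h * this
  rw [hψ n hc, h₁, h₂, conj_eq_of_sq (apply_unit_mul_self χ₂ η), parity_unit hpar]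

/-! ### The terms of the Eisenstein series in terms of rows -/

/-- The value of the linear form with integral coefficients `p` at `z`. -/
noncomputable def rowForm (z : ℍ) (p : ℤ × ℤ) : ℂ := (p.1 : ℂ) * z + p.2

lemma rowForm_ne_zero (z : ℍ) {p : ℤ × ℤ} (hp : p ≠ 0) : rowForm z p ≠ 0 := by
  have h : (![(p.1 : ℝ), (p.2 : ℝ)] : Fin 2 → ℝ) ≠ 0 := by
    intro h
    apply hp
    have h0 := congrFun h 0
    have h1 := congrFun h 1
    ext
    · simpa using h0
    · simpa using h1
  simpa [rowForm] using UpperHalfPlane.linear_ne_zero z h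

lemma cuspRow_ne_zero {w : ℤ} (γ : SL(2, ℤ)) : cuspRow w γ ≠ 0 := by
  intro h
  have hd := sl_det γ
  simp only [cuspRow, Prod.mk_eq_zero] at h
  have h0 : γ.1 1 0 = w * γ.1 0 0 := by linarith [h.1]
  have h1 : γ.1 1 1 = w * γ.1 0 1 := by linarith [h.2]
  rw [h0, h1] at hd
  have : (0 : ℤ) = 1 := by linear_combination hd
  omega

lemma im_smul_real (g : SL(2, ℝ)) (z : ℍ) :
    (g • z).im = z.im / ‖((g.1 1 0 : ℝ) : ℂ) * z + ((g.1 1 1 : ℝ) : ℂ)‖ ^ 2 := by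
  have := UpperHalfPlane.im_smul_eq_div_normSq (Matrix.SpecialLinearGroup.mapGL ℝ g) z
  rw [Complex.normSq_eq_norm_sq] at this
  simp only [Matrix.SpecialLinearGroup.det_mapGL, Units.val_one, abs_one, one_mul] at this
  exact this

lemma cuspTerm_eq {N : ℕ} {k : ℤ} (ψ : DirichletCharacter ℂ N) {w : ℤ} {σ : SL(2, ℝ)} {h : ℕ}
    (hσ : σ.1 1 0 = w * σ.1 0 0) (h0 : σ.1 0 0 ≠ 0) (hh : σ.1 0 0 ^ 2 = h)
    (hk : Odd k → 0 < σ.1 0 0) (z : ℍ) (s : ℂ) (γ : CongruenceSubgroup.Gamma0 N) :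
    cuspTerm N k ψ σ z s γ = conj (ψ ((γ.1.1 1 1 : ℤ) : ZMod N)) *
      (((‖rowForm z (cuspRow w γ.1)‖ : ℝ) : ℂ) / rowForm z (cuspRow w γ.1)) ^ k *
      ((z.im / (h * ‖rowForm z (cuspRow w γ.1)‖ ^ 2) : ℝ) : ℂ) ^ s := by
  obtain ⟨e0, e1⟩ := inv_mul_bottom_row hσ γ
  have hL := rowForm_ne_zero z (cuspRow_ne_zero (w := w) γ.1)
  set a := σ.1 0 0
  have hlin : (((σ⁻¹ * toReal N γ).1 1 0 : ℝ) : ℂ) * z + (((σ⁻¹ * toReal N γ).1 1 1 : ℝ) : ℂ) =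
      (a : ℂ) * rowForm z (cuspRow w γ.1) := by
    rw [e0, e1, rowForm]; push_cast; ring
  unfold cuspTerm
  rw [im_smul_real, jFactor, hlin, norm_mul, mul_pow, Complex.norm_real, Real.norm_eq_abs, sq_abs,
    hh]
  congr 2
  -- The sign of `a` matters only in odd weight, where `a` is positive.
  have ha : (((|a| : ℝ) : ℂ) / (a : ℂ)) ^ k = 1 := by
    rcases Int.even_or_odd k with hev | hodd
    · rcases abs_choice a with h | h
      · rw [h, div_self (by exact_mod_cast h0), one_zpow]
      · rw [h, Complex.ofReal_neg, neg_div, div_self (by exact_mod_cast h0), hev.neg_one_zpow]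
    · rw [abs_of_pos (hk hodd), div_self (by exact_mod_cast h0), one_zpow]
  rw [zpow_neg, ← inv_zpow, inv_div, Complex.ofReal_mul, mul_div_mul_comm, mul_zpow, ha, one_mul]

lemma rowForm_unit_mul (z : ℍ) (η : ℤˣ) (p : ℤ × ℤ) :
    rowForm z (η * p.1, η * p.2) = ((η : ℤ) : ℂ) * rowForm z p := by
  simp only [rowForm]; push_cast; ring

lemma norm_unit (η : ℤˣ) : ‖((η : ℤ) : ℂ)‖ = 1 := by
  rcases Int.units_eq_one_or η with rfl | rfl <;> simp

lemma unit_zpow_inv (η : ℤˣ) (k : ℤ) : (((η : ℤ) : ℂ) ^ k)⁻¹ = ((η : ℤ) : ℂ) ^ k := by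
  rcases Int.units_eq_one_or η with rfl | rfl
  · simp
  · rw [← inv_zpow]; norm_num

lemma isCoprime_lower_right {N : ℕ} (γ : CongruenceSubgroup.Gamma0 N) :
    IsCoprime (γ.1.1 1 1) (N : ℤ) := by
  have h := CongruenceSubgroup.Gamma0_mem.1 γ.2
  rw [ZMod.intCast_zmod_eq_zero_iff_dvd] at h
  obtain ⟨r, hr⟩ : (N : ℤ) ∣ γ.1.1 1 0 := h
  have hd := sl_det γ.1
  rw [hr] at hd
  exact ⟨γ.1.1 0 0, -(γ.1.1 0 1 * r), by linear_combination hd⟩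

/-- The term depends only on the coset of `γ`. -/
lemma cuspTerm_mul {k : ℤ} {N f g m h q₁ q₂ : ℕ} (hN : N = f * g)
    (hf : 0 < f) (hg : 0 < g) (hm : m = Nat.gcd f g) (hh : g = m * h) (hq₂ : q₂ ∣ f) (hq₁ : q₁ ∣ g)
    {χ₁ : DirichletCharacter ℂ q₁} {χ₂ : DirichletCharacter ℂ q₂}
    (hpar : χ₁ (-1) * χ₂ (-1) = (-1 : ℂ) ^ k) {ψ : DirichletCharacter ℂ N}
    (hψ : ∀ n : ℤ, IsCoprime n (N : ℤ) →
      ψ (n : ZMod N) = χ₁ (n : ZMod q₁) * conj (χ₂ (n : ZMod q₂)))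
    {u : ℤ} (hu : IsCoprime u (N : ℤ)) {σ : SL(2, ℝ)}
    (hσ : IsScalingMatrix N (cuspInv (u * f)) σ) (hk : Odd k → 0 < σ.1 0 0) (z : ℍ) (s : ℂ)
    {δ : CongruenceSubgroup.Gamma0 N} (hδ : δ ∈ cuspStabilizer N (cuspInv (u * f)))
    (γ : CongruenceSubgroup.Gamma0 N) :
    cuspTerm N k ψ σ z s (δ * γ) = cuspTerm N k ψ σ z s γ := by
  have ha := hσ.sq_apply_zero_zero hN hf hg hm hh hu
  obtain ⟨b, η, e11, hrow⟩ := cuspRow_mul_of_mem_cuspStabilizer hσ ha hδ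
  have hψδ := nebentypus_of_stabilizer hm hh hq₂ hq₁ hpar hψ e11 (isCoprime_lower_right δ)
  have hψγ : ψ (((δ * γ).1.1 1 1 : ℤ) : ZMod N) =
      ((η : ℤ) : ℂ) ^ k * ψ ((γ.1.1 1 1 : ℤ) : ZMod N) := by
    have hmul : (δ * γ).1.1 1 1 = δ.1.1 1 0 * γ.1.1 0 1 + δ.1.1 1 1 * γ.1.1 1 1 := by
      change (δ.1.1 * γ.1.1) 1 1 = _
      rw [Matrix.mul_apply, Fin.sum_univ_two]
    have h0 : ((δ.1.1 1 0 : ℤ) : ZMod N) = 0 := CongruenceSubgroup.Gamma0_mem.1 δ.2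
    rw [hmul, Int.cast_add, Int.cast_mul, h0, zero_mul, zero_add, Int.cast_mul, map_mul, hψδ]
  rw [cuspTerm_eq ψ hσ.apply_one_zero hσ.apply_zero_zero_ne ha hk,
    cuspTerm_eq ψ hσ.apply_one_zero hσ.apply_zero_zero_ne ha hk, hrow, rowForm_unit_mul, norm_mul,
    norm_unit, one_mul, hψγ, ← one_mul ((‖rowForm z (cuspRow (u * f) γ.1)‖ : ℝ) : ℂ),
    mul_div_mul_comm, mul_zpow, one_div, inv_zpow, unit_zpow_inv, map_mul, one_mul]
  have e1 : conj (((η : ℤ) : ℂ) ^ k) * ((η : ℤ) : ℂ) ^ k = 1 := by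
    rw [map_zpow₀, map_intCast, ← mul_zpow, ← Int.cast_mul]; simp
  linear_combination (conj (ψ ((γ.1.1 1 1 : ℤ) : ZMod N)) *
      (((‖rowForm z (cuspRow (u * f) γ.1)‖ : ℝ) : ℂ) / rowForm z (cuspRow (u * f) γ.1)) ^ k *
      ((z.im / (h * ‖rowForm z (cuspRow (u * f) γ.1)‖ ^ 2) : ℝ) : ℂ) ^ s) * e1

/-! ### The orbit of the row vector of a cusp -/

lemma isCoprime_cuspRow (w : ℤ) (γ : SL(2, ℤ)) : IsCoprime (cuspRow w γ).1 (cuspRow w γ).2 := by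
  refine ⟨-γ.1 0 1, γ.1 0 0, ?_⟩
  simp only [cuspRow]
  linear_combination sl_det γ

/-- The congruences satisfied by the row `(-u f, 1) γ = (f C, D)` for `γ ∈ Γ₀(f g)`. -/
lemma cuspRow_spec {N f g m : ℕ} (hN : N = f * g) (hm : m = Nat.gcd f g) {u : ℤ}
    (hu : IsCoprime u (N : ℤ)) (γ : CongruenceSubgroup.Gamma0 N) :
    ∃ C : ℤ, (cuspRow (u * f) γ.1).1 = f * C ∧ IsCoprime C (g : ℤ) ∧
      (g : ℤ) ∣ C + u * γ.1.1 0 0 ∧ (m : ℤ) ∣ C * (cuspRow (u * f) γ.1).2 + u := by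
  have h := CongruenceSubgroup.Gamma0_mem.1 γ.2
  rw [ZMod.intCast_zmod_eq_zero_iff_dvd] at h
  obtain ⟨r, hr⟩ : (N : ℤ) ∣ γ.1.1 1 0 := h
  have hd := sl_det γ.1
  have hN' : (N : ℤ) = f * g := by exact_mod_cast hN
  rw [hN'] at hr
  obtain ⟨f', hf'⟩ : (m : ℤ) ∣ f := by exact_mod_cast hm ▸ Nat.gcd_dvd_left f g
  obtain ⟨g', hg'⟩ : (m : ℤ) ∣ g := by exact_mod_cast hm ▸ Nat.gcd_dvd_right f g
  refine ⟨g * r - u * γ.1.1 0 0, ?_, ?_, ⟨r, by ring⟩, ?_⟩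
  · simp only [cuspRow]; rw [hr]; ring
  · have h1 : IsCoprime (γ.1.1 0 0) (g : ℤ) :=
      ⟨γ.1.1 1 1, -(γ.1.1 0 1 * f * r), by rw [hr] at hd; linear_combination hd⟩
    have h2 : IsCoprime u (g : ℤ) := hu.of_isCoprime_of_dvd_right ⟨f, by rw [hN']; ring⟩
    have h3 := (h2.mul_left h1).neg_left.add_mul_left_left r
    rwa [show g * r - u * γ.1.1 0 0 = -(u * γ.1.1 0 0) + g * r by ring]
  · simp only [cuspRow]
    refine ⟨g' * r * (γ.1.1 1 1 - u * f * γ.1.1 0 1) + u ^ 2 * γ.1.1 0 0 * f' * γ.1.1 0 1 -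
      u * γ.1.1 0 1 * f' * g * r, ?_⟩
    rw [hr] at hd
    linear_combination (r * (γ.1.1 1 1 - u * f * γ.1.1 0 1)) * hg' +
      (u ^ 2 * γ.1.1 0 0 * γ.1.1 0 1 - u * γ.1.1 0 1 * g * r) * hf' - u * hd

/-- The Chinese remainder theorem for moduli that need not be coprime. -/
lemma exists_dvd_sub_and_dvd_sub {a b x y : ℤ} (h : (Int.gcd a b : ℤ) ∣ x - y) :
    ∃ t : ℤ, a ∣ t - x ∧ b ∣ t - y := by
  obtain ⟨c, hc⟩ := h
  rw [Int.gcd_eq_gcd_ab] at hc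
  exact ⟨x - a * Int.gcdA a b * c, ⟨-(Int.gcdA a b * c), by ring⟩,
    ⟨Int.gcdB a b * c, by linear_combination hc⟩⟩

/-- The congruences of `cuspRow_spec` characterize the orbit of `(-u f, 1)` under `Γ₀(f g)`: the
upper left entry of a matrix with the given row is found by the Chinese remainder theorem. -/
lemma exists_cuspRow_eq {N f g m : ℕ} (hN : N = f * g) (hm : m = Nat.gcd f g) {u : ℤ}
    (hu : IsCoprime u (N : ℤ)) {C D : ℤ} (hCD : IsCoprime (f * C) D) (hCg : IsCoprime C (g : ℤ))
    (hmod : (m : ℤ) ∣ C * D + u) :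
    ∃ γ : CongruenceSubgroup.Gamma0 N, cuspRow (u * f) γ.1 = (f * C, D) := by
  have hN' : (N : ℤ) = f * g := by exact_mod_cast hN
  obtain ⟨v, v', hv⟩ : IsCoprime u (g : ℤ) := hu.of_isCoprime_of_dvd_right ⟨f, by rw [hN']; ring⟩
  obtain ⟨t, y, hy⟩ := id hCD
  have hgcd : (Int.gcd (g : ℤ) (f * C) : ℤ) ∣ -(v * C) - y := by
    have hdm : (Int.gcd (g : ℤ) (f * C) : ℤ) ∣ m := by
      have h1 : IsCoprime (Int.gcd (g : ℤ) (f * C) : ℤ) C :=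
        (hCg.of_isCoprime_of_dvd_right (Int.gcd_dvd_left _ _)).symm
      have h2 : (Int.gcd (g : ℤ) (f * C) : ℤ) ∣ f :=
        h1.dvd_of_dvd_mul_right (Int.gcd_dvd_right _ _)
      have h3 : (Int.gcd (g : ℤ) (f * C) : ℤ) ∣ Int.gcd (f : ℤ) (g : ℤ) :=
        Int.dvd_coe_gcd h2 (Int.gcd_dvd_left _ _)
      rwa [Int.gcd_natCast_natCast, ← hm] at h3
    have hmg : (m : ℤ) ∣ g := by exact_mod_cast hm ▸ Nat.gcd_dvd_right f g
    have hmf : (m : ℤ) ∣ f := by exact_mod_cast hm ▸ Nat.gcd_dvd_left f g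
    refine hdm.trans ?_
    obtain ⟨c, hc⟩ := hmod
    obtain ⟨f', hf'⟩ := hmf
    obtain ⟨g', hg'⟩ := hmg
    -- modulo `m` one has `v u = 1`, `y D = 1` and `C D = -u`
    rw [hf'] at hy
    rw [hg'] at hv
    refine ⟨-v * C * t * f' * C - y * v' * g' - v * y * c, ?_⟩
    linear_combination (v * C) * hy + y * hv - v * y * hc
  obtain ⟨a, ⟨p, hp⟩, ⟨b', hb'⟩⟩ := exists_dvd_sub_and_dvd_sub hgcd
  -- the upper right entry
  obtain ⟨b, hb⟩ : ∃ b, a * D - b * (f * C) = 1 :=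
    ⟨b' * D - t, by linear_combination D * hb' + hy⟩
  let γ : SL(2, ℤ) := ⟨!![a, b; f * C + u * f * a, D + u * f * b], by
    rw [Matrix.det_fin_two_of]; linear_combination hb⟩
  refine ⟨⟨γ, ?_⟩, ?_⟩
  · rw [CongruenceSubgroup.Gamma0_mem, ZMod.intCast_zmod_eq_zero_iff_dvd]
    change (N : ℤ) ∣ f * C + u * f * a
    exact ⟨u * p + v' * C, by rw [hN']; linear_combination u * f * hp - f * C * hv⟩
  · change ((f * C + u * f * a) - u * f * a, (D + u * f * b) - u * f * b) = _
    ext <;> simp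

/-- Rows that agree up to sign come from the same coset of the stabilizer. -/
lemma mul_inv_mem_cuspStabilizer {N : ℕ} {w η : ℤ} (hη : η * η = 1)
    {γ γ' : CongruenceSubgroup.Gamma0 N}
    (h₁ : (cuspRow w γ'.1).1 = η * (cuspRow w γ.1).1)
    (h₂ : (cuspRow w γ'.1).2 = η * (cuspRow w γ.1).2) :
    γ' * γ⁻¹ ∈ cuspStabilizer N (cuspInv w) := by
  have hd := sl_det γ.1
  have hinv : (γ⁻¹).1.1 = !![γ.1.1 1 1, -γ.1.1 0 1; -γ.1.1 1 0, γ.1.1 0 0] := by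
    change ((γ.1)⁻¹).1 = _
    rw [Matrix.SpecialLinearGroup.coe_inv, Matrix.adjugate_fin_two]
  have hmul : ∀ i j, (γ' * γ⁻¹).1.1 i j =
      γ'.1.1 i 0 * (γ⁻¹).1.1 0 j + γ'.1.1 i 1 * (γ⁻¹).1.1 1 j := by
    intro i j
    change (γ'.1.1 * (γ⁻¹).1.1) i j = _
    rw [Matrix.mul_apply, Fin.sum_univ_two]
  refine mem_cuspStabilizer_of_cuspRow hη ?_
  simp only [cuspRow, hmul] at h₁ h₂ ⊢
  rw [hinv]
  simp only [Matrix.of_apply, Matrix.cons_val', Matrix.cons_val_zero, Matrix.cons_val_one,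
    Matrix.cons_val_fin_one]
  ext
  · simp only
    linear_combination γ.1.1 1 1 * h₁ - γ.1.1 1 0 * h₂ - η * w * hd
  · simp only
    linear_combination -γ.1.1 0 1 * h₁ + γ.1.1 0 0 * h₂ + η * hd

/-! ### Matching the pairs `(c, d)` with cosets -/

/-- The pair `ε (d C, e D)` attached to a sign `ε` and a coset with row `(f C, D)`. -/
noncomputable def cosetPair (N : ℕ) (w : ℤ) (f d e : ℕ)
    (x : CuspCosets N (cuspInv w) × ℤˣ) : ℤ × ℤ :=
  (x.2 * (d * ((cuspRow w (Quotient.out x.1).1).1 / f)),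
    x.2 * (e * (cuspRow w (Quotient.out x.1).1).2))

lemma cosetPair_eq {N : ℕ} {w : ℤ} {f d e : ℕ} (hf : 0 < f)
    {x : CuspCosets N (cuspInv w) × ℤˣ} {C : ℤ}
    (hC : (cuspRow w (Quotient.out x.1).1).1 = f * C) :
    cosetPair N w f d e x =
      ((x.2 : ℤ) * (d * C), (x.2 : ℤ) * (e * (cuspRow w (Quotient.out x.1).1).2)) := by
  unfold cosetPair
  rw [hC, Int.mul_ediv_cancel_left _ (by positivity)]

lemma coset_eq_of_cuspRow {N : ℕ} {w η : ℤ} (hη : η * η = 1) {x y : CuspCosets N (cuspInv w)}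
    (h₁ : (cuspRow w (Quotient.out y).1).1 = η * (cuspRow w (Quotient.out x).1).1)
    (h₂ : (cuspRow w (Quotient.out y).1).2 = η * (cuspRow w (Quotient.out x).1).2) : x = y := by
  rw [← Quotient.out_equiv_out]
  exact QuotientGroup.rightRel_apply.2 (mul_inv_mem_cuspStabilizer hη h₁ h₂)

lemma unit_mul_unit (η : ℤˣ) : (η : ℤ) * η = 1 := by
  rw [← Units.val_mul, Int.units_mul_self, Units.val_one]

/-- The sign and the coset are determined by the pair, for a fixed cusp. -/
lemma cosetPair_injective {N f g m : ℕ} (hN : N = f * g) (hf : 0 < f) (hm : m = Nat.gcd f g)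
    {u : ℤ} (hu : IsCoprime u (N : ℤ)) {d e : ℕ} (hd : 0 < d) (he : 0 < e) :
    Function.Injective (cosetPair N (u * f) f d e) := by
  intro x y hxy
  obtain ⟨C, hC, -⟩ := cuspRow_spec hN hm hu (Quotient.out x.1)
  obtain ⟨C', hC', -⟩ := cuspRow_spec hN hm hu (Quotient.out y.1)
  rw [cosetPair_eq hf hC, cosetPair_eq hf hC', Prod.mk.injEq] at hxy
  obtain ⟨h1, h2⟩ := hxy
  have hd' : (d : ℤ) ≠ 0 := by positivity
  have he' : (e : ℤ) ≠ 0 := by positivity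
  have h1' : (x.2 : ℤ) * C = y.2 * C' := mul_left_cancel₀ hd' (by linear_combination h1)
  have h2' : (x.2 : ℤ) * (cuspRow (u * f) (Quotient.out x.1).1).2 =
      y.2 * (cuspRow (u * f) (Quotient.out y.1).1).2 :=
    mul_left_cancel₀ he' (by linear_combination h2)
  have hx := unit_mul_unit x.2
  have hy := unit_mul_unit y.2
  have hc : x.1 = y.1 := by
    refine coset_eq_of_cuspRow (η := y.2 * x.2) (by linear_combination hy * x.2 * x.2 + hx) ?_ ?_
    · rw [hC, hC']; linear_combination -(f * y.2 : ℤ) * h1' - f * C' * hy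
    · linear_combination -(y.2 : ℤ) * h2' - (cuspRow (u * f) (Quotient.out y.1).1).2 * hy
  refine Prod.ext hc ?_
  -- one of the two entries of the row is nonzero, which determines the sign
  have hne := cuspRow_ne_zero (w := u * f) (Quotient.out y.1).1
  rw [hc] at h2' hC
  have hCC : C = C' := mul_left_cancel₀ (show (f : ℤ) ≠ 0 by positivity) (hC.symm.trans hC')
  rw [hCC] at h1'
  by_contra hne2
  have hne3 : (x.2 : ℤ) ≠ y.2 := fun h => hne2 (Units.ext h)
  apply hne
  ext
  · rw [hC']
    have : C' = 0 := by
      by_contra h0; exact hne3 (mul_right_cancel₀ h0 h1')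
    simp [this]
  · by_contra h0; exact hne3 (mul_right_cancel₀ h0 h2')

/-! ### Comparison of the terms -/

lemma conj_apply_mul_apply {q : ℕ} (χ : DirichletCharacter ℂ q) {a b : ZMod q} (hab : a * b = 1) :
    conj (χ b) = χ a := by
  have hb : IsUnit b := IsUnit.of_mul_eq_one_right a hab
  have hn : ‖χ b‖ = 1 := by
    obtain ⟨v, rfl⟩ := hb
    exact χ.unit_norm_eq_one v
  have h1 : χ a * χ b = 1 := by rw [← map_mul, hab, map_one]
  have h2 : χ b * conj (χ b) = 1 := by rw [Complex.mul_conj']; simp [hn]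
  linear_combination (-conj (χ b)) * h1 + χ a * h2

/-- The characters evaluated at the row `(f C, D)` of `γ` give the nebentypus: `D` is congruent
modulo `q₂` to the lower right entry of `γ`, and `C` is congruent modulo `q₁` to `-u` times the
upper left entry, which is inverse to the lower right one. -/
lemma nebentypus_of_cuspRow {N f g q₁ q₂ : ℕ} (hN : N = f * g) (hq₂ : q₂ ∣ f) (hq₁ : q₁ ∣ g)
    {χ₁ : DirichletCharacter ℂ q₁} {χ₂ : DirichletCharacter ℂ q₂} {ψ : DirichletCharacter ℂ N}
    (hψ : ∀ n : ℤ, IsCoprime n (N : ℤ) →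
      ψ (n : ZMod N) = χ₁ (n : ZMod q₁) * conj (χ₂ (n : ZMod q₂)))
    {u : ℤ} (γ : CongruenceSubgroup.Gamma0 N) {C : ℤ} (hC : (g : ℤ) ∣ C + u * γ.1.1 0 0) :
    χ₁ (C : ZMod q₁) * χ₂ ((cuspRow (u * f) γ.1).2 : ZMod q₂) =
      χ₁ ((-u : ℤ) : ZMod q₁) * conj (ψ ((γ.1.1 1 1 : ℤ) : ZMod N)) := by
  have h₂ : ((cuspRow (u * f) γ.1).2 : ZMod q₂) = ((γ.1.1 1 1 : ℤ) : ZMod q₂) := by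
    have : ((f : ℕ) : ZMod q₂) = 0 := by rwa [ZMod.natCast_eq_zero_iff]
    simp only [cuspRow]
    push_cast
    rw [this]; ring
  have h₁ : (C : ZMod q₁) = ((-u : ℤ) : ZMod q₁) * ((γ.1.1 0 0 : ℤ) : ZMod q₁) := by
    have : ((C + u * γ.1.1 0 0 : ℤ) : ZMod q₁) = 0 := by
      rw [ZMod.intCast_zmod_eq_zero_iff_dvd]
      exact (Int.natCast_dvd_natCast.2 hq₁).trans hC
    push_cast at this ⊢
    linear_combination this
  have h₃ : ((γ.1.1 0 0 : ℤ) : ZMod q₁) * ((γ.1.1 1 1 : ℤ) : ZMod q₁) = 1 := by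
    have h0 : ((γ.1.1 1 0 : ℤ) : ZMod q₁) = 0 := by
      have h := CongruenceSubgroup.Gamma0_mem.1 γ.2
      rw [ZMod.intCast_zmod_eq_zero_iff_dvd] at h ⊢
      exact (Int.natCast_dvd_natCast.2 (hN ▸ hq₁.mul_left f)).trans h
    have := congrArg (Int.cast : ℤ → ZMod q₁) (sl_det γ.1)
    push_cast at this
    rwa [h0, mul_zero, sub_zero] at this
  rw [hψ _ (isCoprime_lower_right γ), h₁, h₂, map_mul, map_mul, Complex.conj_conj,
    conj_apply_mul_apply χ₁ h₃, mul_assoc]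

lemma charTerm_eq {q₁ q₂ : ℕ} (k : ℤ) (χ₁ : DirichletCharacter ℂ q₁)
    (χ₂ : DirichletCharacter ℂ q₂) {z L : ℂ} (hz : 0 ≤ z.im) (s : ℂ) {p : ℤ × ℤ}
    (hL : (p.1 : ℂ) * q₂ * z + p.2 = L) (hL0 : L ≠ 0) :
    charTerm k χ₁ χ₂ z s p = χ₁ (p.1 : ZMod q₁) * χ₂ (p.2 : ZMod q₂) *
      ((q₂ * z.im / ‖L‖ ^ 2 : ℝ) : ℂ) ^ s * (((‖L‖ : ℝ) : ℂ) / L) ^ k := by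
  have hn : 0 < ‖L‖ := norm_pos_iff.2 hL0
  have h1 : ((q₂ * z.im / ‖L‖ ^ 2 : ℝ) : ℂ) ^ s * ((‖L‖ : ℝ) : ℂ) ^ (2 * s) =
      ((q₂ * z.im : ℝ) : ℂ) ^ s := by
    rw [two_mul, Complex.cpow_add _ _ (by exact_mod_cast hn.ne'),
      ← Complex.mul_cpow_ofReal_nonneg hn.le hn.le, ← Complex.ofReal_mul,
      ← Complex.mul_cpow_ofReal_nonneg (by positivity) (by positivity), ← Complex.ofReal_mul]
    congr 2
    field_simp
  have h2 : ((‖L‖ : ℝ) : ℂ) ^ (2 * s) ≠ 0 := by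
    rw [Complex.cpow_ne_zero_iff]; left; exact_mod_cast hn.ne'
  unfold charTerm
  rw [hL, ← h1]
  field_simp

/-- The term of the pair attached to a coset is a constant multiple of the term of the coset. -/
lemma charTerm_cosetPair {k : ℤ} {N f g m h q₁ q₂ B d e : ℕ} (hN : N = f * g)
    (hf : 0 < f) (hg : 0 < g) (hm : m = Nat.gcd f g) (hh : g = m * h) (hq₂ : q₂ ∣ f) (hq₁ : q₁ ∣ g)
    (hd : 0 < d) (he : 0 < e) (hB : f * e = q₂ * B * d)
    {χ₁ : DirichletCharacter ℂ q₁} {χ₂ : DirichletCharacter ℂ q₂}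
    (hpar : χ₁ (-1) * χ₂ (-1) = (-1 : ℂ) ^ k) {ψ : DirichletCharacter ℂ N}
    (hψ : ∀ n : ℤ, IsCoprime n (N : ℤ) →
      ψ (n : ZMod N) = χ₁ (n : ZMod q₁) * conj (χ₂ (n : ZMod q₂)))
    {u : ℤ} (hu : IsCoprime u (N : ℤ)) {σ : SL(2, ℝ)}
    (hσ : IsScalingMatrix N (cuspInv (u * f)) σ) (hk : Odd k → 0 < σ.1 0 0) (z : ℍ) (s : ℂ)
    (x : CuspCosets N (cuspInv (u * f)) × ℤˣ) :
    charTerm k χ₁ χ₂ ((B : ℂ) * z) s (cosetPair N (u * f) f d e x) =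
      χ₁ (d : ZMod q₁) * χ₂ (e : ZMod q₂) / ((d * e : ℕ) : ℂ) ^ s * ((N : ℂ) / (m : ℂ)) ^ s *
        (χ₁ ((-u : ℤ) : ZMod q₁) * cuspTerm N k ψ σ z s (Quotient.out x.1)) := by
  set γ := Quotient.out x.1 with hγ
  obtain ⟨C, hC, -, hCu, -⟩ := cuspRow_spec hN hm hu γ
  have hneb := nebentypus_of_cuspRow hN hq₂ hq₁ hψ γ hCu
  have ha := hσ.sq_apply_zero_zero hN hf hg hm hh hu
  have hL0 := rowForm_ne_zero z (cuspRow_ne_zero (w := u * f) γ.1)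
  have hm0 : 0 < m := hm ▸ Nat.gcd_pos_of_pos_left g hf
  have hh0 : 0 < h := by rw [hh] at hg; exact Nat.pos_of_mul_pos_left hg
  rw [cuspTerm_eq ψ hσ.apply_one_zero hσ.apply_zero_zero_ne ha hk z s, cosetPair_eq hf hC, ← hγ]
  have hform : rowForm z (cuspRow (u * f) γ.1) =
      (f : ℂ) * C * z + ((cuspRow (u * f) γ.1).2 : ℂ) := by
    rw [rowForm, hC]; push_cast; ring
  set L := rowForm z (cuspRow (u * f) γ.1)
  set D := (cuspRow (u * f) γ.1).2
  set η := x.2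
  have hη0 : ((η : ℤ) : ℂ) ≠ 0 := by
    rw [← norm_pos_iff, norm_unit]; exact one_pos
  have he0 : (e : ℂ) ≠ 0 := by exact_mod_cast he.ne'
  have hn : 0 < ‖L‖ := norm_pos_iff.2 hL0
  have hlin : ((((η : ℤ) * (d * C), (η : ℤ) * (e * D)) : ℤ × ℤ).1 : ℂ) * q₂ * ((B : ℂ) * z) +
      ((((η : ℤ) * (d * C), (η : ℤ) * (e * D)) : ℤ × ℤ).2 : ℂ) = ((η : ℤ) : ℂ) * (e * L) := by
    have hB' : (f : ℂ) * e = q₂ * B * d := by exact_mod_cast hB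
    rw [hform]; push_cast
    linear_combination (-((η : ℤ) : ℂ) * C * z) * hB'
  have him : ((B : ℂ) * z).im = B * z.im := by
    simp [Complex.mul_im]
  rw [charTerm_eq k χ₁ χ₂ (by rw [him]; have := z.im_pos; positivity) s hlin
    (mul_ne_zero hη0 (mul_ne_zero he0 hL0)), him]
  have hpow : ((q₂ * (B * z.im) / ‖((η : ℤ) : ℂ) * (e * L)‖ ^ 2 : ℝ) : ℂ) ^ s *
      ((d * e : ℕ) : ℂ) ^ s =
      ((N : ℂ) / (m : ℂ)) ^ s * ((z.im / (h * ‖L‖ ^ 2) : ℝ) : ℂ) ^ s := by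
    have hz := z.im_pos
    have e1 : ((d * e : ℕ) : ℂ) = ((d * e : ℝ) : ℂ) := by push_cast; ring
    have e2 : (N : ℂ) / (m : ℂ) = ((N / m : ℝ) : ℂ) := by push_cast; ring
    rw [e1, e2, ← Complex.mul_cpow_ofReal_nonneg (by positivity) (by positivity),
      ← Complex.mul_cpow_ofReal_nonneg (by positivity) (by positivity), ← Complex.ofReal_mul,
      ← Complex.ofReal_mul]
    congr 2
    have hB' : (f : ℝ) * e = q₂ * B * d := by exact_mod_cast hB
    have hN' : (N : ℝ) = f * (m * h) := by rw [hN, hh]; push_cast; ring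
    rw [norm_mul, norm_unit, one_mul, norm_mul, Complex.norm_natCast, hN']
    field_simp
    linear_combination -hB'
  have hde : ((d * e : ℕ) : ℂ) ^ s ≠ 0 := by
    rw [Complex.cpow_ne_zero_iff]; left; exact_mod_cast (Nat.mul_pos hd he).ne'
  have hphase : (((‖((η : ℤ) : ℂ) * (e * L)‖ : ℝ) : ℂ) / (((η : ℤ) : ℂ) * (e * L))) ^ k =
      ((η : ℤ) : ℂ) ^ k * (((‖L‖ : ℝ) : ℂ) / L) ^ k := by
    rw [← mul_zpow]
    congr 1
    rw [norm_mul, norm_unit, one_mul, norm_mul, Complex.norm_natCast]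
    have hηη : ((η : ℤ) : ℂ) * η = 1 := by exact_mod_cast unit_mul_unit η
    push_cast
    field_simp
    linear_combination (-((‖L‖ : ℝ) : ℂ)) * hηη
  have hchar : χ₁ (((η : ℤ) * (d * C) : ℤ) : ZMod q₁) * χ₂ (((η : ℤ) * (e * D) : ℤ) : ZMod q₂) =
      ((η : ℤ) : ℂ) ^ k * (χ₁ (d : ZMod q₁) * χ₂ (e : ZMod q₂)) *
        (χ₁ (C : ZMod q₁) * χ₂ (D : ZMod q₂)) := by
    rw [← parity_unit hpar η]
    push_cast
    simp only [map_mul]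
    ring
  rw [hphase, hchar, hneb]
  have hsq : ((η : ℤ) : ℂ) ^ k * ((η : ℤ) : ℂ) ^ k = 1 := by
    rw [← mul_zpow, ← Int.cast_mul, unit_mul_unit]; simp
  rw [eq_div_of_mul_eq hde hpow]
  field_simp
  linear_combination (χ₁ (d : ZMod q₁) * χ₂ (e : ZMod q₂) * χ₁ ((-u : ℤ) : ZMod q₁) *
    conj (ψ ((γ.1.1 1 1 : ℤ) : ZMod N)) * ((N : ℂ) / (m : ℂ)) ^ s *
    ((z.im / (h * ‖L‖ ^ 2) : ℝ) : ℂ) ^ s * (((‖L‖ : ℝ) : ℂ) / L) ^ k) * hsq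

/-! ### Absolute convergence -/

lemma summable_norm_rowForm (z : ℍ) {r : ℝ} (hr : 1 < r) :
    Summable fun p : ℤ × ℤ => (‖rowForm z p‖ ^ 2)⁻¹ ^ r := by
  have h1 := (EisensteinSeries.summable_one_div_norm_rpow (k := 2 * r) (by linarith)).mul_left
    (EisensteinSeries.r z ^ (-(2 * r)))
  have h2 : Summable fun x : Fin 2 → ℤ => ‖(x 0 : ℂ) * z + x 1‖ ^ (-(2 * r)) :=
    Summable.of_nonneg_of_le (fun x => by positivity)
      (fun x => EisensteinSeries.summand_bound z (by linarith) x) h1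
  rw [← (finTwoArrowEquiv ℤ).symm.summable_iff] at h2
  refine h2.congr fun p => ?_
  simp only [Function.comp_apply, finTwoArrowEquiv_symm_apply, Matrix.cons_val_zero,
    Matrix.cons_val_one, Matrix.cons_val_fin_one]
  change ‖rowForm z p‖ ^ (-(2 * r)) = _
  rw [Real.rpow_neg (norm_nonneg _), Real.rpow_mul (norm_nonneg _), Real.inv_rpow (by positivity),
    Real.rpow_two]

lemma norm_phase (L : ℂ) (k : ℤ) (hL : L ≠ 0) : ‖(((‖L‖ : ℝ) : ℂ) / L) ^ k‖ = 1 := by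
  rw [norm_zpow, norm_div, Complex.norm_real, norm_norm, div_self (norm_ne_zero_iff.2 hL),
    one_zpow]

lemma summable_of_norm_le {ι : Type*} {F : ι → ℂ} (z : ℍ) {s : ℂ} (hs : 1 < s.re) (K : ℝ)
    {φ : ι → ℤ × ℤ} (hφ : Function.Injective φ)
    (h : ∀ i, ‖F i‖ ≤ K * (‖rowForm z (φ i)‖ ^ 2)⁻¹ ^ s.re) : Summable F :=
  Summable.of_norm_bounded (((summable_norm_rowForm z hs).comp_injective hφ).mul_left K) h

lemma summable_cuspTerm {N : ℕ} {k : ℤ} (ψ : DirichletCharacter ℂ N) {w : ℤ} {σ : SL(2, ℝ)} {h : ℕ}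
    (hσ : IsScalingMatrix N (cuspInv w) σ) (h0 : 0 < h) (hh : σ.1 0 0 ^ 2 = h)
    (hk : Odd k → 0 < σ.1 0 0) (z : ℍ) {s : ℂ} (hs : 1 < s.re) :
    Summable fun c : CuspCosets N (cuspInv w) => cuspTerm N k ψ σ z s (Quotient.out c) := by
  refine summable_of_norm_le z hs ((z.im / h) ^ s.re)
    (φ := fun c : CuspCosets N (cuspInv w) => cuspRow w (Quotient.out c).1) ?_ ?_
  · intro x y (hxy : cuspRow w (Quotient.out x).1 = cuspRow w (Quotient.out y).1)
    have h' := hxy.symm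
    exact coset_eq_of_cuspRow (η := 1) (by norm_num) (by rw [h', one_mul]) (by rw [h', one_mul])
  · intro c
    have hL := rowForm_ne_zero z (cuspRow_ne_zero (w := w) (Quotient.out c).1)
    have hn := norm_pos_iff.2 hL
    have hz := z.im_pos
    have hh' : (0 : ℝ) < h := by exact_mod_cast h0
    rw [cuspTerm_eq ψ hσ.apply_one_zero hσ.apply_zero_zero_ne hh hk, norm_mul, norm_mul,
      norm_phase _ _ hL, mul_one, Complex.norm_cpow_eq_rpow_re_of_pos (by positivity),
      ← Real.mul_rpow (by positivity) (by positivity), RCLike.norm_conj]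
    refine (mul_le_of_le_one_left (by positivity) (ψ.norm_le_one _)).trans (le_of_eq ?_)
    congr 1
    field_simp

lemma summable_charTerm {q₁ q₂ B : ℕ} (hq : 0 < q₂) (hB : 0 < B) (k : ℤ)
    (χ₁ : DirichletCharacter ℂ q₁) (χ₂ : DirichletCharacter ℂ q₂) (z : ℍ) {s : ℂ}
    (hs : 1 < s.re) :
    Summable fun p : {p : ℤ × ℤ // IsCoprime p.1 p.2} =>
      charTerm k χ₁ χ₂ ((B : ℂ) * z) s p.1 := by
  have him : ((B : ℂ) * z).im = B * z.im := by simp [Complex.mul_im]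
  have hqB : (q₂ * B : ℤ) ≠ 0 := by positivity
  refine summable_of_norm_le z hs ((q₂ * (B * z.im)) ^ s.re)
    (φ := fun p : {p : ℤ × ℤ // IsCoprime p.1 p.2} => (p.1.1 * (q₂ * B), p.1.2)) ?_ ?_
  · rintro ⟨⟨c, d⟩, _⟩ ⟨⟨c', d'⟩, _⟩ hxy
    simp only [Prod.mk.injEq] at hxy
    obtain ⟨h1, rfl⟩ := hxy
    obtain rfl := mul_right_cancel₀ hqB h1
    rfl
  · rintro ⟨⟨c, d⟩, hcd⟩
    simp only at hcd ⊢
    have hne : ((c * (q₂ * B), d) : ℤ × ℤ) ≠ 0 := by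
      intro h
      simp only [Prod.mk_eq_zero, mul_eq_zero, hqB, or_false] at h
      rw [h.1, h.2] at hcd
      exact not_isCoprime_zero_zero hcd
    have hL := rowForm_ne_zero z hne
    have hn := norm_pos_iff.2 hL
    have hz := z.im_pos
    rw [charTerm_eq k χ₁ χ₂ (L := rowForm z (c * (q₂ * B), d)) (by rw [him]; positivity) s
      (by simp only [rowForm]; push_cast; ring) hL, norm_mul, norm_phase _ _ hL, mul_one,
      norm_mul, him, Complex.norm_cpow_eq_rpow_re_of_pos (by positivity),
      ← Real.mul_rpow (by positivity) (by positivity), div_eq_mul_inv]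
    refine mul_le_of_le_one_left (by positivity) ?_
    rw [norm_mul]
    exact mul_le_one₀ (χ₁.norm_le_one _) (norm_nonneg _) (χ₂.norm_le_one _)

/-! ### The pairs `(c, d)` are partitioned by the cusps -/

lemma coprimeDivisors_spec {A B : ℕ} {p : ℕ × ℕ} (hp : p ∈ coprimeDivisors A B) (hA : 0 < A)
    (hB : 0 < B) :
    ∃ a b : ℕ, A = p.1 * a ∧ B = p.2 * b ∧ Nat.Coprime p.1 p.2 ∧ 0 < p.1 ∧ 0 < p.2 ∧ 0 < a ∧
      0 < b ∧ B * p.1 / p.2 = b * p.1 ∧ A * p.2 / p.1 = a * p.2 := by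
  simp only [coprimeDivisors, Finset.mem_filter, Finset.mem_product, Nat.mem_divisors] at hp
  obtain ⟨⟨⟨⟨a, rfl⟩, -⟩, ⟨⟨b, rfl⟩, -⟩⟩, hc⟩ := hp
  have h1 := Nat.pos_of_mul_pos_right hA
  have h2 := Nat.pos_of_mul_pos_right hB
  refine ⟨a, b, rfl, rfl, hc, h1, h2, Nat.pos_of_mul_pos_left hA, Nat.pos_of_mul_pos_left hB,
    ?_, ?_⟩
  · rw [mul_assoc, Nat.mul_div_cancel_left _ h2]
  · rw [mul_assoc, Nat.mul_div_cancel_left _ h1]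

/-- The arithmetic of the parameters attached to a pair `(d, e)`: `f` is the gcd of `N` with the
denominators of the cusps and `g = N / f`. -/
lemma level_spec {N q₁ q₂ A B : ℕ} (hNpos : 0 < N) (hN : N = q₁ * q₂ * (A * B)) {p : ℕ × ℕ}
    (hp : p ∈ coprimeDivisors A B) :
    ∃ f g a b : ℕ, f = q₂ * (B * p.1 / p.2) ∧ N = f * g ∧ 0 < f ∧ 0 < g ∧
      gcdModulus q₁ q₂ A B p = Nat.gcd f g ∧ A = p.1 * a ∧ B = p.2 * b ∧ f = q₂ * (b * p.1) ∧
      g = q₁ * (a * p.2) ∧ Nat.Coprime p.1 p.2 ∧ 0 < p.1 ∧ 0 < p.2 := by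
  have hA : 0 < A := Nat.pos_of_ne_zero (by rintro rfl; simp at hN; omega)
  have hB : 0 < B := Nat.pos_of_ne_zero (by rintro rfl; simp at hN; omega)
  have hq₁ : 0 < q₁ := Nat.pos_of_ne_zero (by rintro rfl; simp at hN; omega)
  have hq₂ : 0 < q₂ := Nat.pos_of_ne_zero (by rintro rfl; simp at hN; omega)
  obtain ⟨a, b, eA, eB, hc, h1, h2, ha, hb, e1, e2⟩ := coprimeDivisors_spec hp hA hB
  refine ⟨q₂ * (B * p.1 / p.2), q₁ * (A * p.2 / p.1), a, b, rfl, ?_, ?_, ?_, rfl, eA, eB,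
    by rw [e1], by rw [e2], hc, h1, h2⟩
  · rw [e1, e2, hN]; conv_lhs => rw [eA, eB]
    ring
  · rw [e1]; positivity
  · rw [e2]; positivity

/-- The pair `ε (d C, e D)` is coprime, and it determines `d`, `e` and `u` modulo `m`. -/
lemma cosetPair_spec {N f g m q₁ q₂ A B d e a b : ℕ} (hN : N = f * g) (hf : 0 < f)
    (hm : m = Nat.gcd f g) (hA : A = d * a) (hB : B = e * b) (hfb : f = q₂ * (b * d))
    (hga : g = q₁ * (a * e)) (hde : Nat.Coprime d e) {u : ℤ} (hu : IsCoprime u (N : ℤ))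
    (x : CuspCosets N (cuspInv (u * f)) × ℤˣ) :
    IsCoprime (cosetPair N (u * f) f d e x).1 (cosetPair N (u * f) f d e x).2 ∧
      Int.gcd (cosetPair N (u * f) f d e x).1 A = d ∧
      Int.gcd (cosetPair N (u * f) f d e x).2 B = e ∧
      ∃ n : ℤ, (cosetPair N (u * f) f d e x).1 * (cosetPair N (u * f) f d e x).2 = d * e * n ∧
        (m : ℤ) ∣ n + u := by
  obtain ⟨C, hC, hCg, -, hmod⟩ := cuspRow_spec hN hm hu (Quotient.out x.1)
  have hcop := isCoprime_cuspRow (u * f) (Quotient.out x.1).1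
  rw [cosetPair_eq hf hC]
  rw [hC] at hcop
  set D := (cuspRow (u * f) (Quotient.out x.1).1).2
  set η := x.2
  have hη : IsUnit (η : ℤ) := η.isUnit
  have hdD : IsCoprime (d : ℤ) D :=
    hcop.of_isCoprime_of_dvd_left ⟨q₂ * b * C, by rw [hfb]; push_cast; ring⟩
  have hbD : IsCoprime (b : ℤ) D :=
    hcop.of_isCoprime_of_dvd_left ⟨q₂ * d * C, by rw [hfb]; push_cast; ring⟩
  have hCD : IsCoprime C D := hcop.of_isCoprime_of_dvd_left (Dvd.intro_left _ rfl)
  have hCe : IsCoprime C (e : ℤ) :=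
    hCg.of_isCoprime_of_dvd_right ⟨q₁ * a, by rw [hga]; push_cast; ring⟩
  have hCa : IsCoprime C (a : ℤ) :=
    hCg.of_isCoprime_of_dvd_right ⟨q₁ * e, by rw [hga]; push_cast; ring⟩
  have hde' : IsCoprime (d : ℤ) (e : ℤ) := Nat.isCoprime_iff_coprime.2 hde
  refine ⟨?_, ?_, ?_, C * D, ?_, hmod⟩
  · refine (isCoprime_mul_unit_left_left hη _ _).2 ((isCoprime_mul_unit_left_right hη _ _).2 ?_)
    exact (hde'.mul_left hCe).mul_right (hdD.mul_left hCD)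
  · have : Int.gcd ((η : ℤ) * (d * C)) A = Int.gcd (d * C) A := by
      rcases Int.units_eq_one_or η with h | h <;> simp [h]
    simp only [this]
    rw [hA, Nat.cast_mul, Int.gcd_mul_left, Int.isCoprime_iff_gcd_eq_one.1 hCa]
    simp
  · have : Int.gcd ((η : ℤ) * (e * D)) B = Int.gcd (e * D) B := by
      rcases Int.units_eq_one_or η with h | h <;> simp [h]
    simp only [this]
    rw [hB, Nat.cast_mul, Int.gcd_mul_left, Int.isCoprime_iff_gcd_eq_one.1 hbD.symm]
    simp
  · linear_combination (d * e * C * D : ℤ) * unit_mul_unit η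

lemma isCoprime_of_apply_ne_zero {q : ℕ} {χ : DirichletCharacter ℂ q} {n : ℤ}
    (h : χ (n : ZMod q) ≠ 0) : IsCoprime n (q : ℤ) := by
  have hu : IsUnit (n : ZMod q) := by
    by_contra h'; exact h (χ.map_nonunit h')
  exact ((ZMod.coe_int_isUnit_iff_isCoprime n q).1 hu).symm

/-- Every coprime pair at which the characters do not vanish comes from some cusp and coset:
`d = (c, A)`, `e = (d', B)`. -/
lemma exists_cosetPair_eq {N q₁ q₂ A B : ℕ} (hNpos : 0 < N) (hN : N = q₁ * q₂ * (A * B))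
    {R : ℕ × ℕ → Finset ℤ}
    (hR : ∀ p ∈ coprimeDivisors A B, IsUnitReps N (gcdModulus q₁ q₂ A B p) (R p))
    {σ : ℤ → SL(2, ℝ)}
    (hσ : ∀ w ∈ cuspDenominators q₂ A B R, IsScalingMatrix N (cuspInv w) (σ w))
    {c d' : ℤ} (hcd : IsCoprime c d') (hc : IsCoprime c (q₁ : ℤ)) (hd : IsCoprime d' (q₂ : ℤ)) :
    ∃ p ∈ coprimeDivisors A B, ∃ u ∈ R p,
      ∃ x : CuspCosets N (cuspInv (u * ((q₂ * (B * p.1 / p.2) : ℕ) : ℤ))) × ℤˣ,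
        cosetPair N (u * ((q₂ * (B * p.1 / p.2) : ℕ) : ℤ)) (q₂ * (B * p.1 / p.2)) p.1 p.2 x =
          (c, d') := by
  have hA : 0 < A := Nat.pos_of_ne_zero (by rintro rfl; simp at hN; omega)
  have hB : 0 < B := Nat.pos_of_ne_zero (by rintro rfl; simp at hN; omega)
  have hdc : ((Int.gcd c A : ℕ) : ℤ) ∣ c := Int.gcd_dvd_left _ _
  have hed : ((Int.gcd d' B : ℕ) : ℤ) ∣ d' := Int.gcd_dvd_left _ _
  have hp : (Int.gcd c A, Int.gcd d' B) ∈ coprimeDivisors A B := by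
    simp only [coprimeDivisors, Finset.mem_filter, Finset.mem_product, Nat.mem_divisors]
    refine ⟨⟨⟨?_, hA.ne'⟩, ⟨?_, hB.ne'⟩⟩, ?_⟩
    · exact Int.natCast_dvd_natCast.1 (Int.gcd_dvd_right _ _)
    · exact Int.natCast_dvd_natCast.1 (Int.gcd_dvd_right _ _)
    · rw [← Nat.isCoprime_iff_coprime]
      exact (hcd.of_isCoprime_of_dvd_left hdc).of_isCoprime_of_dvd_right hed
  refine ⟨_, hp, ?_⟩
  obtain ⟨f, g, a, b, hf, hNfg, hf0, hg0, hm, eA, eB, hfb, hga, hde, hd0, he0⟩ :=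
    level_spec hNpos hN hp
  have hRp := hR _ hp
  have hmem : ∀ u ∈ R (Int.gcd c A, Int.gcd d' B), u * (f : ℤ) ∈ cuspDenominators q₂ A B R :=
    fun u hu => ⟨_, hp, u, hu, by rw [hf]⟩
  rw [← hf]
  obtain ⟨C, hC⟩ := hdc
  obtain ⟨D, hD⟩ := hed
  simp only at eA eB hfb hga hde hd0 he0 ⊢
  set d := Int.gcd c A with hd_def
  set e := Int.gcd d' B with he_def
  have hdvC : C ∣ c := ⟨d, by linear_combination hC⟩
  have hdvD : D ∣ d' := ⟨e, by linear_combination hD⟩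
  have hdvd : (d : ℤ) ∣ c := ⟨C, hC⟩
  have hdve : (e : ℤ) ∣ d' := ⟨D, hD⟩
  have hCa : IsCoprime C (a : ℤ) := by
    rw [Int.isCoprime_iff_gcd_eq_one]
    have h := hd_def
    rw [hC, eA, Nat.cast_mul, Int.gcd_mul_left, Int.natAbs_natCast] at h
    exact (Nat.eq_of_mul_eq_mul_left hd0 (by rw [mul_one]; exact h)).symm
  have hDb : IsCoprime D (b : ℤ) := by
    rw [Int.isCoprime_iff_gcd_eq_one]
    have h := he_def
    rw [hD, eB, Nat.cast_mul, Int.gcd_mul_left, Int.natAbs_natCast] at h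
    exact (Nat.eq_of_mul_eq_mul_left he0 (by rw [mul_one]; exact h)).symm
  have hCg : IsCoprime C (g : ℤ) := by
    rw [hga]; push_cast
    exact (hc.of_isCoprime_of_dvd_left hdvC).mul_right (hCa.mul_right
      ((hcd.of_isCoprime_of_dvd_left hdvC).of_isCoprime_of_dvd_right hdve))
  have hfD : IsCoprime (f : ℤ) D := by
    rw [hfb]; push_cast
    exact (hd.of_isCoprime_of_dvd_left hdvD).symm.mul_left (hDb.symm.mul_left
      ((hcd.of_isCoprime_of_dvd_left hdvd).of_isCoprime_of_dvd_right hdvD))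
  have hCD : IsCoprime (f * C) D :=
    hfD.mul_left ((hcd.of_isCoprime_of_dvd_left hdvC).of_isCoprime_of_dvd_right hdvD)
  set m := gcdModulus q₁ q₂ A B (d, e) with hm_def
  have hmf : (m : ℤ) ∣ f := by exact_mod_cast hm ▸ Nat.gcd_dvd_left f g
  have hmg : (m : ℤ) ∣ g := by exact_mod_cast hm ▸ Nat.gcd_dvd_right f g
  -- the representative `u` of the class of `-C D`
  have hunit : IsUnit ((-(C * D) : ℤ) : ZMod m) := by
    rw [ZMod.coe_int_isUnit_iff_isCoprime]
    exact ((hCg.of_isCoprime_of_dvd_right hmg).symm.mul_right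
      (hfD.of_isCoprime_of_dvd_left hmf)).neg_right
  obtain ⟨v, hv⟩ := hunit
  obtain ⟨u, ⟨huR, huv⟩, -⟩ := hRp.2 v
  have hu := hRp.1 u huR
  have hmod : (m : ℤ) ∣ C * D + u := by
    rw [← ZMod.intCast_zmod_eq_zero_iff_dvd]
    push_cast
    rw [huv, hv]; push_cast; ring
  obtain ⟨γ, hγ⟩ := exists_cuspRow_eq hNfg hm hu hCD hCg hmod
  have hsc := hσ _ (hmem u huR)
  obtain ⟨h, hh⟩ : m ∣ g := Int.natCast_dvd_natCast.1 hmg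
  have hsq := hsc.sq_apply_zero_zero hNfg hf0 hg0 hm hh hu
  -- the chosen representative of the coset of `γ` has the row of `γ` up to a sign
  have hout : Quotient.out (Quotient.mk (QuotientGroup.rightRel (cuspStabilizer N
      (cuspInv (u * f)))) γ) * γ⁻¹ ∈ cuspStabilizer N (cuspInv (u * f)) := by
    rw [← QuotientGroup.rightRel_apply]
    exact Setoid.symm' _ (Quotient.mk_out (s := QuotientGroup.rightRel _) γ)
  obtain ⟨-, η, -, hrow⟩ := cuspRow_mul_of_mem_cuspStabilizer hsc hsq hout
  have hrow' := hrow γ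
  rw [inv_mul_cancel_right, hγ] at hrow'
  have hηη := unit_mul_unit η
  refine ⟨u, huR, (Quotient.mk _ γ, η), ?_⟩
  rw [cosetPair_eq hf0 (C := η * C) (by rw [hrow']; simp only; ring), hrow']
  ext
  · simp only; rw [hC]; linear_combination (d * C : ℤ) * hηη
  · simp only; rw [hD]; linear_combination (e * D : ℤ) * hηη

/-! ### The identity in the half-plane of absolute convergence -/

section Identity

variable {k : ℤ} {N q₁ q₂ A B : ℕ} {χ₁ : DirichletCharacter ℂ q₁} {χ₂ : DirichletCharacter ℂ q₂}
  {ψ : DirichletCharacter ℂ N} {R : ℕ × ℕ → Finset ℤ} {σ : ℤ → SL(2, ℝ)}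

lemma cuspTerm_mul_of_mem_cuspDenominators (hNpos : 0 < N) (hN : N = q₁ * q₂ * (A * B))
    (hpar : χ₁ (-1) * χ₂ (-1) = (-1 : ℂ) ^ k)
    (hψ : ∀ n : ℤ, IsCoprime n (N : ℤ) →
      ψ (n : ZMod N) = χ₁ (n : ZMod q₁) * conj (χ₂ (n : ZMod q₂)))
    (hR : ∀ p ∈ coprimeDivisors A B, IsUnitReps N (gcdModulus q₁ q₂ A B p) (R p))
    (hσ : ∀ w ∈ cuspDenominators q₂ A B R,
      IsScalingMatrix N (cuspInv w) (σ w) ∧ (Odd k → 0 < (σ w).1 0 0))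
    (z : ℍ) {w : ℤ} (hw : w ∈ cuspDenominators q₂ A B R) {δ : CongruenceSubgroup.Gamma0 N}
    (hδ : δ ∈ cuspStabilizer N (cuspInv w)) (γ : CongruenceSubgroup.Gamma0 N) (s : ℂ) :
    cuspTerm N k ψ (σ w) z s (δ * γ) = cuspTerm N k ψ (σ w) z s γ := by
  obtain ⟨hsc, hk⟩ := hσ w hw
  obtain ⟨p, hp, u, hu, rfl⟩ := hw
  obtain ⟨f, g, a, b, hf, hNfg, hf0, hg0, hm, eA, eB, hfb, hga, hde, hd0, he0⟩ :=
    level_spec hNpos hN hp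
  rw [← hf] at hsc hk hδ ⊢
  obtain ⟨h, hh⟩ : gcdModulus q₁ q₂ A B p ∣ g := hm ▸ Nat.gcd_dvd_right f g
  exact cuspTerm_mul hNfg hf0 hg0 hm hh ⟨_, hfb⟩ ⟨_, hga⟩ hpar hψ ((hR p hp).1 u hu) hsc hk z s
    hδ γ

lemma summable_cuspTerm_of_mem_cuspDenominators (hNpos : 0 < N) (hN : N = q₁ * q₂ * (A * B))
    (hR : ∀ p ∈ coprimeDivisors A B, IsUnitReps N (gcdModulus q₁ q₂ A B p) (R p))
    (hσ : ∀ w ∈ cuspDenominators q₂ A B R,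
      IsScalingMatrix N (cuspInv w) (σ w) ∧ (Odd k → 0 < (σ w).1 0 0))
    (z : ℍ) {w : ℤ} (hw : w ∈ cuspDenominators q₂ A B R) {s : ℂ} (hs : 1 < s.re) :
    Summable fun c : CuspCosets N (cuspInv w) => cuspTerm N k ψ (σ w) z s (Quotient.out c) := by
  obtain ⟨hsc, hk⟩ := hσ w hw
  obtain ⟨p, hp, u, hu, rfl⟩ := hw
  obtain ⟨f, g, a, b, hf, hNfg, hf0, hg0, hm, -⟩ := level_spec hNpos hN hp
  rw [← hf] at hsc hk ⊢
  obtain ⟨h, hh⟩ : gcdModulus q₁ q₂ A B p ∣ g := hm ▸ Nat.gcd_dvd_right f g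
  have hh0 : 0 < h := by rw [hh] at hg0; exact Nat.pos_of_mul_pos_left hg0
  exact summable_cuspTerm ψ hsc hh0
    (hsc.sq_apply_zero_zero hNfg hf0 hg0 hm hh ((hR p hp).1 u hu)) hk z hs

lemma eq_of_dvd_add {m : ℕ} {S : Finset ℤ} (hS : IsUnitReps N m S) (hmN : m ∣ N) {u u' n : ℤ}
    (hu : u ∈ S) (hu' : u' ∈ S) (h : (m : ℤ) ∣ n + u) (h' : (m : ℤ) ∣ n + u') : u = u' := by
  have hunit : IsUnit (u : ZMod m) := by
    rw [ZMod.coe_int_isUnit_iff_isCoprime]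
    exact ((hS.1 u hu).of_isCoprime_of_dvd_right (Int.natCast_dvd_natCast.2 hmN)).symm
  obtain ⟨v, hv⟩ := hunit
  refine (hS.2 v).unique ⟨hu, hv.symm⟩ ⟨hu', ?_⟩
  rw [hv, ← sub_eq_zero, ← Int.cast_sub, ZMod.intCast_zmod_eq_zero_iff_dvd]
  have := dvd_sub h' h
  rwa [add_sub_add_left_eq_sub] at this

lemma tsum_prod_units {ι : Type*} {F : ι → ℂ} (hF : Summable fun x : ι × ℤˣ => F x.1) :
    ∑' x : ι × ℤˣ, F x.1 = 2 * ∑' i, F i := by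
  rw [hF.tsum_prod, ← tsum_mul_left]
  refine tsum_congr fun i => ?_
  simp [tsum_fintype]

/-- The pairs `(p, u)` indexing the cusps that occur. -/
abbrev CuspIndex (A B : ℕ) (R : ℕ × ℕ → Finset ℤ) : Type :=
  ↥((coprimeDivisors A B).sigma R)

/-- The denominator of the cusp of index `(p, u)`. -/
def CuspIndex.denominator {A B : ℕ} {R : ℕ × ℕ → Finset ℤ} (q₂ : ℕ) (i : CuspIndex A B R) : ℤ :=
  i.1.2 * ((q₂ * (B * i.1.1.1 / i.1.1.2) : ℕ) : ℤ)

lemma CuspIndex.mem {A B : ℕ} {R : ℕ × ℕ → Finset ℤ} (i : CuspIndex A B R) :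
    i.1.1 ∈ coprimeDivisors A B ∧ i.1.2 ∈ R i.1.1 := Finset.mem_sigma.1 i.2

lemma CuspIndex.denominator_mem {A B : ℕ} {R : ℕ × ℕ → Finset ℤ} (q₂ : ℕ) (i : CuspIndex A B R) :
    i.denominator q₂ ∈ cuspDenominators q₂ A B R := ⟨i.1.1, i.mem.1, i.1.2, i.mem.2, rfl⟩

/-- The cosets for all cusps that occur, each taken with both signs, together with the pair of
integers they give. -/
noncomputable def indexedPair (N q₂ A B : ℕ) (R : ℕ × ℕ → Finset ℤ)
    (t : Σ i : CuspIndex A B R, CuspCosets N (cuspInv (i.denominator q₂)) × ℤˣ) : ℤ × ℤ :=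
  cosetPair N (t.1.denominator q₂) (q₂ * (B * t.1.1.1.1 / t.1.1.1.2)) t.1.1.1.1 t.1.1.1.2 t.2

lemma indexedPair_spec (hNpos : 0 < N) (hN : N = q₁ * q₂ * (A * B))
    (hR : ∀ p ∈ coprimeDivisors A B, IsUnitReps N (gcdModulus q₁ q₂ A B p) (R p))
    (t : Σ i : CuspIndex A B R, CuspCosets N (cuspInv (i.denominator q₂)) × ℤˣ) :
    IsCoprime (indexedPair N q₂ A B R t).1 (indexedPair N q₂ A B R t).2 ∧
      Int.gcd (indexedPair N q₂ A B R t).1 A = t.1.1.1.1 ∧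
      Int.gcd (indexedPair N q₂ A B R t).2 B = t.1.1.1.2 ∧
      ∃ n : ℤ, (indexedPair N q₂ A B R t).1 * (indexedPair N q₂ A B R t).2 =
        t.1.1.1.1 * t.1.1.1.2 * n ∧ (gcdModulus q₁ q₂ A B t.1.1.1 : ℤ) ∣ n + t.1.1.2 := by
  obtain ⟨⟨⟨p, u⟩, hi⟩, x⟩ := t
  obtain ⟨hp, hu⟩ := Finset.mem_sigma.1 hi
  obtain ⟨f, g, a, b, rfl, hNfg, hf0, hg0, hm, eA, eB, hfb, hga, hde, hd0, he0⟩ :=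
    level_spec hNpos hN hp
  exact cosetPair_spec hNfg hf0 hm eA eB hfb hga hde ((hR p hp).1 u hu) x

lemma indexedPair_injective (hNpos : 0 < N) (hN : N = q₁ * q₂ * (A * B))
    (hR : ∀ p ∈ coprimeDivisors A B, IsUnitReps N (gcdModulus q₁ q₂ A B p) (R p)) :
    Function.Injective (indexedPair N q₂ A B R) := by
  intro t t' h
  obtain ⟨-, hd, he, n, hn, hmod⟩ := indexedPair_spec hNpos hN hR t
  obtain ⟨-, hd', he', n', hn', hmod'⟩ := indexedPair_spec hNpos hN hR t'
  rw [← h] at hd' he' hn'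
  obtain ⟨⟨⟨p, u⟩, hi⟩, x⟩ := t
  obtain ⟨⟨⟨p', u'⟩, hi'⟩, x'⟩ := t'
  simp only at hd he hn hmod hd' he' hn' hmod'
  obtain rfl : p = p' := Prod.ext (hd.symm.trans hd') (he.symm.trans he')
  obtain ⟨hp, hu⟩ := Finset.mem_sigma.1 hi
  obtain ⟨-, hu'⟩ := Finset.mem_sigma.1 hi'
  obtain ⟨f, g, a, b, rfl, hNfg, hf0, hg0, hm, eA, eB, hfb, hga, hde, hd0, he0⟩ :=
    level_spec hNpos hN hp
  obtain rfl : n = n' := by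
    have h0 : (p.1 * p.2 : ℤ) ≠ 0 := by positivity
    exact mul_left_cancel₀ h0 (hn.symm.trans hn')
  have hmN : gcdModulus q₁ q₂ A B p ∣ N := by
    rw [hm, hNfg]; exact (Nat.gcd_dvd_left _ _).mul_right g
  obtain rfl : u = u' := eq_of_dvd_add (hR p hp) hmN hu hu' hmod hmod'
  have := cosetPair_injective hNfg hf0 hm ((hR p hp).1 u hu) hd0 he0 h
  exact Sigma.ext rfl (heq_of_eq this)

/-- The terms of `E_{χ₁, χ₂}` at which the characters do not vanish are indexed, via
`indexedPair`, by the cusps, cosets and signs; the two signs account for the factor `1 / 2`. -/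
theorem charEisenstein_eq_cuspCombination (hNpos : 0 < N) (hN : N = q₁ * q₂ * (A * B))
    (hpar : χ₁ (-1) * χ₂ (-1) = (-1 : ℂ) ^ k)
    (hψ : ∀ n : ℤ, IsCoprime n (N : ℤ) →
      ψ (n : ZMod N) = χ₁ (n : ZMod q₁) * conj (χ₂ (n : ZMod q₂)))
    (hR : ∀ p ∈ coprimeDivisors A B, IsUnitReps N (gcdModulus q₁ q₂ A B p) (R p))
    (hσ : ∀ w ∈ cuspDenominators q₂ A B R,
      IsScalingMatrix N (cuspInv w) (σ w) ∧ (Odd k → 0 < (σ w).1 0 0))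
    (z : ℍ) {s : ℂ}
    (hsum : Summable fun p : {p : ℤ × ℤ // IsCoprime p.1 p.2} =>
      charTerm k χ₁ χ₂ ((B : ℂ) * z) s p.1) :
    charEisenstein k χ₁ χ₂ ((B : ℂ) * z) s =
      cuspCombination χ₁ χ₂ N A B R s fun w => cuspEisenstein N k ψ (cuspInv w) (σ w) z s := by
  let J : (Σ i : CuspIndex A B R, CuspCosets N (cuspInv (i.denominator q₂)) × ℤˣ) →
      {p : ℤ × ℤ // IsCoprime p.1 p.2} :=
    fun t => ⟨indexedPair N q₂ A B R t, (indexedPair_spec hNpos hN hR t).1⟩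
  have hJ : Function.Injective J := fun t t' h =>
    indexedPair_injective hNpos hN hR (congrArg Subtype.val h)
  have hsupp : Function.support (fun p : {p : ℤ × ℤ // IsCoprime p.1 p.2} =>
      charTerm k χ₁ χ₂ ((B : ℂ) * z) s p.1) ⊆ Set.range J := by
    rintro ⟨⟨c, d⟩, hcd⟩ hne
    have hne1 : χ₁ (c : ZMod q₁) ≠ 0 := fun h => hne (by simp [charTerm, h])
    have hne2 : χ₂ (d : ZMod q₂) ≠ 0 := fun h => hne (by simp [charTerm, h])
    obtain ⟨p, hp, u, hu, x, hx⟩ := exists_cosetPair_eq hNpos hN hR (fun w hw => (hσ w hw).1) hcd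
      (isCoprime_of_apply_ne_zero hne1) (isCoprime_of_apply_ne_zero hne2)
    exact ⟨⟨⟨⟨p, u⟩, Finset.mem_sigma.2 ⟨hp, hu⟩⟩, x⟩, Subtype.ext hx⟩
  have hsumJ := hsum.comp_injective hJ
  unfold charEisenstein
  rw [← hJ.tsum_eq hsupp]
  let K : (Σ _ : ℕ × ℕ, ℤ) → ℂ := fun j =>
    χ₁ (j.1.1 : ZMod q₁) * χ₂ (j.1.2 : ZMod q₂) / ((j.1.1 * j.1.2 : ℕ) : ℂ) ^ s *
      ((N : ℂ) / (gcdModulus q₁ q₂ A B j.1 : ℂ)) ^ s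
  let w : (Σ _ : ℕ × ℕ, ℤ) → ℤ := fun j => j.2 * ((q₂ * (B * j.1.1 / j.1.2) : ℕ) : ℤ)
  let T : ∀ i : CuspIndex A B R, CuspCosets N (cuspInv (w i.1)) → ℂ := fun i c =>
    K i.1 * (χ₁ ((-i.1.2 : ℤ) : ZMod q₁) * cuspTerm N k ψ (σ (w i.1)) z s (Quotient.out c))
  have hterm : ∀ (i : CuspIndex A B R) (x : CuspCosets N (cuspInv (w i.1)) × ℤˣ),
      charTerm k χ₁ χ₂ ((B : ℂ) * z) s (J ⟨i, x⟩).1 = T i x.1 := by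
    intro i x
    obtain ⟨hsc, hk⟩ := hσ _ (i.denominator_mem q₂)
    obtain ⟨⟨p, u⟩, hi⟩ := i
    obtain ⟨hp, hu⟩ := Finset.mem_sigma.1 hi
    obtain ⟨f, g, a, b, rfl, hNfg, hf0, hg0, hm, eA, eB, hfb, hga, hde, hd0, he0⟩ :=
      level_spec hNpos hN hp
    obtain ⟨h, hh⟩ : gcdModulus q₁ q₂ A B p ∣ g := hm ▸ Nat.gcd_dvd_right _ g
    have hB : q₂ * (B * p.1 / p.2) * p.2 = q₂ * B * p.1 := by
      rw [hfb]; conv_rhs => rw [eB]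
      ring
    exact charTerm_cosetPair hNfg hf0 hg0 hm hh ⟨_, rfl⟩ ⟨_, hga⟩ hd0 he0 hB hpar hψ
      ((hR p hp).1 u hu) hsc hk z s x
  have hfib : ∀ i : CuspIndex A B R,
      ∑' x : CuspCosets N (cuspInv (w i.1)) × ℤˣ,
        charTerm k χ₁ χ₂ ((B : ℂ) * z) s (J ⟨i, x⟩).1 =
      2 * (K i.1 * (χ₁ ((-i.1.2 : ℤ) : ZMod q₁) *
        cuspEisenstein N k ψ (cuspInv (w i.1)) (σ (w i.1)) z s)) := by
    intro i
    have hs : Summable fun x : CuspCosets N (cuspInv (w i.1)) × ℤˣ =>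
        charTerm k χ₁ χ₂ ((B : ℂ) * z) s (J ⟨i, x⟩).1 :=
      hsumJ.comp_injective sigma_mk_injective
    rw [tsum_congr (hterm i), tsum_prod_units (F := T i) (hs.congr (hterm i))]
    simp only [T]
    rw [tsum_mul_left, tsum_mul_left]
    rfl
  have h2 : ∑' t, charTerm k χ₁ χ₂ ((B : ℂ) * z) s (J t).1 =
      ∑ i : CuspIndex A B R, ∑' x : CuspCosets N (cuspInv (w i.1)) × ℤˣ,
        charTerm k χ₁ χ₂ ((B : ℂ) * z) s (J ⟨i, x⟩).1 := by
    rw [← tsum_fintype (L := SummationFilter.unconditional _)]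
    exact hsumJ.tsum_sigma
  rw [h2, Finset.sum_congr rfl fun i _ => hfib i, ← Finset.mul_sum, ← mul_assoc,
    one_div_mul_cancel two_ne_zero, one_mul,
    Finset.sum_coe_sort ((coprimeDivisors A B).sigma R) fun j => K j * (χ₁ ((-j.2 : ℤ) : ZMod q₁) *
      cuspEisenstein N k ψ (cuspInv (w j)) (σ (w j)) z s), Finset.sum_sigma]
  unfold cuspCombination
  refine Finset.sum_congr rfl fun p _ => ?_
  rw [Finset.mul_sum]

end Identity

/-! ### Analytic continuation -/

/-- The identity principle for a meromorphic function on `ℂ` vanishing on a half-plane. -/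
lemma eq_zero_of_meromorphic {f : ℂ → ℂ} (hf : Meromorphic f) (h0 : ∀ s : ℂ, 1 < s.re → f s = 0)
    {s : ℂ} (hs : ContinuousAt f s) : f s = 0 := by
  have htop : ∀ u, meromorphicOrderAt f u = ⊤ := by
    by_contra! h
    refine (hf.exists_meromorphicOrderAt_ne_top_iff_forall.1 h 2) ?_
    rw [meromorphicOrderAt_eq_top_iff]
    have hopen : IsOpen {s : ℂ | 1 < s.re} := isOpen_lt continuous_const Complex.continuous_re
    have : ∀ᶠ z in nhds (2 : ℂ), f z = 0 := by
      filter_upwards [hopen.mem_nhds (by simp : (2 : ℂ) ∈ {s : ℂ | 1 < s.re})] with z hz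
      exact h0 z hz
    exact this.filter_mono nhdsWithin_le_nhds
  have hev := meromorphicOrderAt_eq_top_iff.1 (htop s)
  have h1 : Filter.Tendsto f (nhdsWithin s {s}ᶜ) (nhds (f s)) := hs.mono_left nhdsWithin_le_nhds
  have h2 : Filter.Tendsto f (nhdsWithin s {s}ᶜ) (nhds 0) :=
    tendsto_const_nhds.congr' (hev.mono fun z hz => hz.symm)
  exact tendsto_nhds_unique h1 h2

lemma analyticAt_const_cpow {c : ℂ} (hc : c ≠ 0) (s : ℂ) : AnalyticAt ℂ (fun t => c ^ t) s :=
  (differentiable_id.const_cpow (Or.inl hc)).analyticAt s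

/-- The coefficients of the linear combination are entire functions of `s`, so a property of
functions at a point that is stable under sums and products and holds for analytic functions
passes to the linear combination. -/
lemma cuspCombination_induction {N q₁ q₂ A B : ℕ} (hNpos : 0 < N) (hN : N = q₁ * q₂ * (A * B))
    (χ₁ : DirichletCharacter ℂ q₁) (χ₂ : DirichletCharacter ℂ q₂) {R : ℕ × ℕ → Finset ℤ}
    {Ψ : ℤ → ℂ → ℂ} {s : ℂ} {P : (ℂ → ℂ) → Prop} (hPa : ∀ f, AnalyticAt ℂ f s → P f)
    (hadd : ∀ f g, P f → P g → P (fun t => f t + g t))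
    (hmul : ∀ f g, P f → P g → P (fun t => f t * g t))
    (hΨ : ∀ w ∈ cuspDenominators q₂ A B R, P (Ψ w)) :
    P (fun t => cuspCombination χ₁ χ₂ N A B R t fun w => Ψ w t) := by
  have hsum : ∀ {ι : Type} (S : Finset ι) (F : ι → ℂ → ℂ), (∀ i ∈ S, P (F i)) →
      P (fun t => ∑ i ∈ S, F i t) := by
    intro ι S F hF
    induction S using Finset.cons_induction with
    | empty => exact hPa _ (by simpa using analyticAt_const)
    | cons a S ha ih =>
      simp only [Finset.sum_cons]
      exact hadd _ _ (hF a (by simp)) (ih fun i hi => hF i (by simp [hi]))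
  unfold cuspCombination
  refine hsum _ _ fun p hp => ?_
  obtain ⟨f, g, a, b, hf, hNfg, hf0, hg0, hm, eA, eB, hfb, hga, hde, hd0, he0⟩ :=
    level_spec hNpos hN hp
  have hm0 : gcdModulus q₁ q₂ A B p ≠ 0 := hm ▸ (Nat.gcd_pos_of_pos_left g hf0).ne'
  refine hmul _ _ (hPa _ ?_) (hsum _ _ fun u hu => hmul _ _ (hPa _ analyticAt_const)
    (hΨ _ ⟨p, hp, u, hu, rfl⟩))
  have hde0 : ((p.1 * p.2 : ℕ) : ℂ) ≠ 0 := by exact_mod_cast (Nat.mul_pos hd0 he0).ne'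
  have hNm : (N : ℂ) / (gcdModulus q₁ q₂ A B p : ℂ) ≠ 0 :=
    div_ne_zero (by exact_mod_cast hNpos.ne') (by exact_mod_cast hm0)
  refine (analyticAt_const.div (analyticAt_const_cpow hde0 s) ?_).mul (analyticAt_const_cpow hNm s)
  rw [Complex.cpow_ne_zero_iff]
  exact Or.inl hde0

end EisensteinCusps

theorem mainTheorem2 (k : ℤ) (N q₁ q₂ A B : ℕ) (hNpos : 0 < N) (hN : N = q₁ * q₂ * (A * B))
    (χ₁ : DirichletCharacter ℂ q₁) (χ₂ : DirichletCharacter ℂ q₂)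
    (hχ₁ : χ₁.IsPrimitive) (hχ₂ : χ₂.IsPrimitive)
    (hpar : χ₁ (-1) * χ₂ (-1) = (-1 : ℂ) ^ k)
    (ψ : DirichletCharacter ℂ N)
    (hψ : ∀ n : ℤ, IsCoprime n (N : ℤ) →
      ψ (n : ZMod N) = χ₁ (n : ZMod q₁) * conj (χ₂ (n : ZMod q₂)))
    (R : ℕ × ℕ → Finset ℤ)
    (hR : ∀ p ∈ EisensteinCusps.coprimeDivisors A B,
      EisensteinCusps.IsUnitReps N (EisensteinCusps.gcdModulus q₁ q₂ A B p) (R p))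
    (σ : ℤ → SL(2, ℝ))
    (hσ : ∀ w ∈ EisensteinCusps.cuspDenominators q₂ A B R,
      EisensteinCusps.IsScalingMatrix N (EisensteinCusps.cuspInv w) (σ w) ∧
        (Odd k → 0 < (σ w).1 0 0))
    (z : ℍ) :
    (∀ w ∈ EisensteinCusps.cuspDenominators q₂ A B R,
      ∀ δ ∈ EisensteinCusps.cuspStabilizer N (EisensteinCusps.cuspInv w),
        ∀ (γ : CongruenceSubgroup.Gamma0 N) (s : ℂ),
          EisensteinCusps.cuspTerm N k ψ (σ w) z s (δ * γ) =
            EisensteinCusps.cuspTerm N k ψ (σ w) z s γ) ∧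
    (∀ s : ℂ, 1 < s.re →
      (Summable fun p : {p : ℤ × ℤ // IsCoprime p.1 p.2} =>
        EisensteinCusps.charTerm k χ₁ χ₂ ((B : ℂ) * z) s p.1) ∧
      (∀ w ∈ EisensteinCusps.cuspDenominators q₂ A B R,
        Summable fun c : EisensteinCusps.CuspCosets N (EisensteinCusps.cuspInv w) =>
          EisensteinCusps.cuspTerm N k ψ (σ w) z s (Quotient.out c)) ∧
      EisensteinCusps.charEisenstein k χ₁ χ₂ ((B : ℂ) * z) s =
        EisensteinCusps.cuspCombination χ₁ χ₂ N A B R s fun w =>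
          EisensteinCusps.cuspEisenstein N k ψ (EisensteinCusps.cuspInv w) (σ w) z s) ∧
    (∀ (Φ : ℂ → ℂ) (Ψ : ℤ → ℂ → ℂ), Meromorphic Φ →
      (∀ w ∈ EisensteinCusps.cuspDenominators q₂ A B R, Meromorphic (Ψ w)) →
      (∀ s : ℂ, 1 < s.re → Φ s = EisensteinCusps.charEisenstein k χ₁ χ₂ ((B : ℂ) * z) s) →
      (∀ w ∈ EisensteinCusps.cuspDenominators q₂ A B R, ∀ s : ℂ, 1 < s.re →
        Ψ w s = EisensteinCusps.cuspEisenstein N k ψ (EisensteinCusps.cuspInv w) (σ w) z s) →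
      ∀ s : ℂ, AnalyticAt ℂ Φ s →
        (∀ w ∈ EisensteinCusps.cuspDenominators q₂ A B R, AnalyticAt ℂ (Ψ w) s) →
        Φ s = EisensteinCusps.cuspCombination χ₁ χ₂ N A B R s fun w => Ψ w s) := by
  have hsum : ∀ s : ℂ, 1 < s.re → Summable fun p : {p : ℤ × ℤ // IsCoprime p.1 p.2} =>
      EisensteinCusps.charTerm k χ₁ χ₂ ((B : ℂ) * z) s p.1 := fun s hs =>
    EisensteinCusps.summable_charTerm (Nat.pos_of_ne_zero (by rintro rfl; simp at hN; omega))
      (Nat.pos_of_ne_zero (by rintro rfl; simp at hN; omega)) k χ₁ χ₂ z hs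
  have hident : ∀ s : ℂ, 1 < s.re → EisensteinCusps.charEisenstein k χ₁ χ₂ ((B : ℂ) * z) s =
      EisensteinCusps.cuspCombination χ₁ χ₂ N A B R s fun w =>
        EisensteinCusps.cuspEisenstein N k ψ (EisensteinCusps.cuspInv w) (σ w) z s := fun s hs =>
    EisensteinCusps.charEisenstein_eq_cuspCombination hNpos hN hpar hψ hR hσ z (hsum s hs)
  refine ⟨fun w hw δ hδ γ s =>
    EisensteinCusps.cuspTerm_mul_of_mem_cuspDenominators hNpos hN hpar hψ hR hσ z hw hδ γ s,
    fun s hs => ⟨hsum s hs, fun w hw =>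
      EisensteinCusps.summable_cuspTerm_of_mem_cuspDenominators hNpos hN hR hσ z hw hs,
      hident s hs⟩, ?_⟩
  intro Φ Ψ hΦ hΨ hΦeq hΨeq s hΦs hΨs
  have hmer : Meromorphic fun t => EisensteinCusps.cuspCombination χ₁ χ₂ N A B R t fun w => Ψ w t :=
    fun x => EisensteinCusps.cuspCombination_induction (s := x) hNpos hN χ₁ χ₂
      (P := fun f => MeromorphicAt f x) (fun f hf => hf.meromorphicAt) (fun f g hf hg => hf.add hg)
      (fun f g hf hg => hf.mul hg) fun w hw => hΨ w hw x
  have hana : AnalyticAt ℂ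
      (fun t => EisensteinCusps.cuspCombination χ₁ χ₂ N A B R t fun w => Ψ w t) s :=
    EisensteinCusps.cuspCombination_induction hNpos hN χ₁ χ₂
      (P := fun f => AnalyticAt ℂ f s) (fun f hf => hf) (fun f g hf hg => hf.add hg)
      (fun f g hf hg => hf.mul hg) hΨs
  refine sub_eq_zero.1 (EisensteinCusps.eq_zero_of_meromorphic (hΦ.sub hmer) (fun t ht => ?_)
    (hΦs.sub hana).continuousAt)
  simp only [Pi.sub_apply]
  rw [hΦeq t ht, hident t ht, sub_eq_zero]
  unfold EisensteinCusps.cuspCombination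
  refine Finset.sum_congr rfl fun p hp => ?_
  congr 1
  exact Finset.sum_congr rfl fun u hu =>
    congrArg (χ₁ _ * ·) (hΨeq _ ⟨p, hp, u, hu, rfl⟩ t ht).symm
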